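/- For $n\ge 0$ let $[n]=\{1,\dots,n\}$. Let $m_n$ be the number of (labelled) matroids with ground set $[n]$. A matroid $M$ is called paving if each circuit of $M$ has cardinality at least the rank of $M$, and sparse paving if both $M$ and its dual $M^*$ are paving; let $s_n$ be the number of sparse paving matroids with ground set $[n]$. Then $$\log_2 m_n = (1+o(1))\,\log_2 s_n \qquad\text{as } n\to\infty,$$ that is, there is a real sequence $(\varepsilon_n)$ with $\varepsilon_n\to 0$ such that $\log_2 m_n=(1+\varepsilon_n)\log_2 s_n$ for all sufficiently large $n$. -/

import Mathlib

open Filter Topology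

/-- A matroid is paving if each of its circuits has cardinality at least its rank. -/
def Matroid.IsPaving {α : Type*} (M : Matroid α) : Prop :=
  ∀ C : Set α, M.IsCircuit C → M.eRank ≤ C.encard

/-- A matroid is sparse paving if both it and its dual are paving. -/
def Matroid.IsSparsePaving {α : Type*} (M : Matroid α) : Prop :=
  M.IsPaving ∧ M.dual.IsPaving

/-- The set of all (labelled) matroids whose ground set is the whole `n`-element set `Fin n`. -/
def matroidsOn (n : ℕ) : Set (Matroid (Fin n)) :=
  {M | M.E = Set.univ}

/-- There are finitely many matroids on a finite type, so the cardinalities below are genuine. -/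
theorem finite_matroid_of_finite {α : Type*} [Finite α] : Finite (Matroid α) := by
  refine Finite.of_injective
    (fun M : Matroid α => ((M.E, {B | M.IsBase B}) : Set α × Set (Set α))) ?_
  intro M N h
  have h1 : M.E = N.E := congrArg Prod.fst h
  have h2 : {B | M.IsBase B} = {B | N.IsBase B} := congrArg Prod.snd h
  exact Matroid.ext_isBase h1 fun B _ => Set.ext_iff.mp h2 B

/-- The number `m_n` of matroids on `n` labelled elements. -/
noncomputable def numMatroids (n : ℕ) : ℕ :=
  (matroidsOn n).ncard

/-- The number `s_n` of sparse paving matroids on `n` labelled elements. -/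
noncomputable def numSparsePaving (n : ℕ) : ℕ :=
  {M ∈ matroidsOn n | M.IsSparsePaving}.ncard

/-!
A matroid of rank `r` on `n` elements is determined by its nonbases, the dependent `r`-sets, viewed
as vertices of the Johnson graph, where two `r`-sets are adjacent if they differ by one exchange.
For `0 < r < n`, every stable set `I` of this graph is the set of nonbases of a sparse paving
matroid (`sparsePavingOf`). Splitting the middle layer by the sum of the elements modulo `n` gives a large
stable set, and its subsets show `log₂ sₙ ≥ n.choose (n / 2) / n` (`two_pow_le_numSparsePaving`).
It therefore suffices to describe every matroid of rank `r` by a stable set together with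
`o(n.choose (n / 2) / n)` bits of further information.

A dependent `r`-set `X` of nullity at least two has only dependent neighbours. If `X` has nullity
one, every dependent neighbour of `X` contains the circuit of `X` or lies in the closure of `X`
(`circuit_subset_or_subset_closure`). So a short list of circuits, closures and sets of nullity at
least two covers all nonbases with many dependent neighbours: a greedy choice of members gives a
small family meeting all large neighbourhoods (`exists_small_hitting`). With threshold
`δ = n ^ (3 / 2)` the list has `O(log n * n ^ (-3 / 2) * n.choose r)` members. The sets of nullity
one left uncovered form a family of Johnson degree at most `δ`, hence of size
`O(n ^ (-1 / 2) * n.choose r)` by Cauchy–Schwarz (`card_le_of_johnson_degree_le`). Therefore a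
second round with the smaller threshold `n / 16` costs no more, and afterwards every uncovered
nonbasis has fewer than `n / 16` uncovered neighbours of nullity one.

Take a maximal stable family `I` of uncovered nonbases. Any other uncovered nonbasis `Y` is adjacent
to some `X` in `I`. As `X` has few dependent neighbours, its circuit is large and its closure is
small. Therefore the pair `X`, `Y` lies in a large clique of the Johnson graph that consists mostly
of neighbours of `X` of nullity one, and some set in that clique is covered.
The circuit or flat covering that set reveals that the exchange from `X` to `Y` preserves dependence
(`isForcedExchange_of_johnsonAdj`). Hence the short lists and `I` determine all nonbases
(`decode`, `exists_decode_eq_nonbases`). As there are only `exp (o(n.choose (n / 2) / n))` short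
lists (`card_smallFamilies_le`), and the ranks below `n / 8` and above `7 * n / 8` are negligible,
the claim follows.
-/

/-! ### Johnson adjacency and stable families -/

/-- Two finite sets are adjacent in the Johnson graph if one arises from the other by exchanging
a single element for a new one. Adjacent sets automatically have the same cardinality. -/
def JohnsonAdj {α : Type*} [DecidableEq α] (X Y : Finset α) : Prop :=
  ∃ x ∈ X, ∃ y ∉ X, Y = insert y (X.erase x)

/-- A family of `r`-sets, no two of which are adjacent in the Johnson graph. -/
def IsStableFamily {α : Type*} [DecidableEq α] (r : ℕ) (I : Finset (Finset α)) : Prop :=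
  (∀ X ∈ I, X.card = r) ∧ ∀ X ∈ I, ∀ Y ∈ I, ¬ JohnsonAdj X Y

section Johnson
variable {α : Type*} [DecidableEq α]

theorem JohnsonAdj.symm {X Y : Finset α} (h : JohnsonAdj X Y) : JohnsonAdj Y X := by
  obtain ⟨x, hx, y, hy, rfl⟩ := h
  have hxy : x ≠ y := fun h => hy (h ▸ hx)
  refine ⟨y, by simp, x, by simp [hxy], ?_⟩
  ext a
  simp only [Finset.mem_insert, Finset.mem_erase]
  grind

theorem card_insert_erase {X : Finset α} {x y : α} (hx : x ∈ X) (hy : y ∉ X) :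
    (insert y (X.erase x)).card = X.card := by
  rw [Finset.card_insert_of_notMem (fun h => hy (Finset.mem_of_mem_erase h)),
    Finset.card_erase_of_mem hx]
  have := Finset.card_pos.2 ⟨x, hx⟩
  omega

theorem JohnsonAdj.card_eq {X Y : Finset α} (h : JohnsonAdj X Y) : Y.card = X.card := by
  obtain ⟨x, hx, y, hy, rfl⟩ := h
  exact card_insert_erase hx hy

theorem JohnsonAdj.ne {X Y : Finset α} (h : JohnsonAdj X Y) : X ≠ Y := by
  obtain ⟨x, hx, y, hy, rfl⟩ := h
  intro h
  exact hy (h ▸ Finset.mem_insert_self _ _)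

theorem JohnsonAdj.of_insert {Z : Finset α} {x y : α} (hx : x ∉ Z) (hy : y ∉ Z) (hxy : x ≠ y) :
    JohnsonAdj (insert x Z) (insert y Z) :=
  ⟨x, by simp, y, by simp [hxy.symm, hy], by rw [Finset.erase_insert hx]⟩

theorem JohnsonAdj.of_erase {W : Finset α} {x y : α} (hx : x ∈ W) (hy : y ∈ W) (hxy : x ≠ y) :
    JohnsonAdj (W.erase x) (W.erase y) := by
  refine ⟨y, by simp [hxy.symm, hy], x, by simp, ?_⟩
  ext a
  simp only [Finset.mem_insert, Finset.mem_erase]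
  grind

/-- Exchanging elements is injective in the pair of exchanged elements. -/
theorem insert_erase_injOn (X : Finset α) :
    Set.InjOn (fun p : α × α => insert p.2 (X.erase p.1)) {p | p.1 ∈ X ∧ p.2 ∉ X} := by
  rintro ⟨x, y⟩ ⟨hx, hy⟩ ⟨x', y'⟩ ⟨hx', hy'⟩ h
  simp only [Finset.ext_iff, Finset.mem_insert, Finset.mem_erase] at h
  simp only at hx hy hx' hy'
  have h1 := h x
  have h2 := h y
  grind

theorem IsStableFamily.subset {r : ℕ} {I J : Finset (Finset α)} (h : IsStableFamily r J)
    (hIJ : I ⊆ J) : IsStableFamily r I :=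
  ⟨fun X hX => h.1 X (hIJ hX), fun X hX Y hY => h.2 X (hIJ hX) Y (hIJ hY)⟩

/-- Every family of `r`-sets has a stable subfamily that dominates it. -/
theorem exists_maximal_stable (r : ℕ) (V : Finset (Finset α)) (hV : ∀ X ∈ V, X.card = r) :
    ∃ I ⊆ V, IsStableFamily r I ∧ ∀ Y ∈ V, Y ∈ I ∨ ∃ X ∈ I, JohnsonAdj X Y := by
  classical
  obtain ⟨I, hI⟩ := (V.powerset.filter (IsStableFamily r)).exists_maximal
    ⟨∅, by simp [IsStableFamily]⟩
  have hIm := hI.1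
  simp only [Finset.mem_filter, Finset.mem_powerset] at hIm
  refine ⟨I, hIm.1, hIm.2, fun Y hY => ?_⟩
  by_contra! hcon
  have hst : IsStableFamily r (insert Y I) := by
    refine ⟨fun X hX => ?_, fun X hX X' hX' hadj => ?_⟩
    · rcases Finset.mem_insert.1 hX with rfl | hX
      · exact hV _ hY
      · exact hIm.2.1 _ hX
    · rw [Finset.mem_insert] at hX hX'
      rcases hX with rfl | hX
      · rcases hX' with rfl | hX'
        · exact hadj.ne rfl
        · exact hcon.2 _ hX' hadj.symm
      · rcases hX' with rfl | hX'
        · exact hcon.2 _ hX hadj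
        · exact hIm.2.2 _ hX _ hX' hadj
  have := hI.2 (y := insert Y I) (by
    simp only [Finset.mem_filter, Finset.mem_powerset]
    exact ⟨Finset.insert_subset hY hIm.1, hst⟩) (Finset.subset_insert _ _)
  exact hcon.1 (this (Finset.mem_insert_self _ _))

end Johnson

open Classical in
/-- The number of Johnson neighbours of `X` in a family `F`. -/
noncomputable abbrev johnsonDegree {α : Type*} [DecidableEq α] (F : Finset (Finset α))
    (X : Finset α) : ℕ :=
  (F.filter (JohnsonAdj X)).card

open Classical in
/-- If exchanging any `x ∈ A ⊆ X` for any `y ∈ B` outside `X` leads into `F`, then `X` has at least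
`#A * #B` Johnson neighbours in `F`. -/
theorem card_mul_card_le_johnson_degree {α : Type*} [DecidableEq α] (X A B : Finset α)
    (F : Finset (Finset α)) (hA : A ⊆ X) (hB : ∀ y ∈ B, y ∉ X)
    (h : ∀ x ∈ A, ∀ y ∈ B, insert y (X.erase x) ∈ F) :
    A.card * B.card ≤ johnsonDegree F X := by
  rw [← Finset.card_product]
  refine Finset.card_le_card_of_injOn (fun p => insert p.2 (X.erase p.1)) ?_
    ((insert_erase_injOn X).mono ?_)
  · rintro ⟨x, y⟩ hp
    simp only [Finset.coe_product, Set.mem_prod, Finset.mem_coe] at hp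
    exact Finset.mem_filter.2 ⟨h x hp.1 y hp.2, x, hA hp.1, y, hB y hp.2, rfl⟩
  · rintro ⟨x, y⟩ hp
    simp only [Finset.coe_product, Set.mem_prod, Finset.mem_coe] at hp
    exact ⟨hA hp.1, hB y hp.2⟩

/-! ### Small hitting sets -/

open Classical in
/-- Greedy choice: if every `t ∈ T` is related to at least `δ` elements of `K`, then some element
of `K` hits a fraction `δ / #K` of `T`; repeating this `m` times leaves few elements unhit. -/
theorem exists_hitting_of_steps {β : Type*} [DecidableEq β] (K T : Finset β) (R : β → β → Prop)
    (δ : ℝ) (hδ : δ ≤ K.card) (hK : K.Nonempty)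
    (h : ∀ t ∈ T, δ ≤ ((K.filter (R t)).card : ℝ)) (m : ℕ) :
    ∃ S ⊆ K, S.card ≤ m ∧
      ((T.filter fun t => ∀ s ∈ S, ¬ R t s).card : ℝ) ≤ T.card * (1 - δ / K.card) ^ m := by
  have hKpos : (0 : ℝ) < K.card := by exact_mod_cast hK.card_pos
  have hfac : 0 ≤ 1 - δ / K.card := by
    rw [sub_nonneg, div_le_one hKpos]; exact hδ
  induction m with
  | zero => exact ⟨∅, by simp, by simp, by simp⟩
  | succ m ih =>
    obtain ⟨S, hSK, hSm, hS⟩ := ih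
    set T' := T.filter fun t => ∀ s ∈ S, ¬ R t s with hT'
    have hdc : ∑ k ∈ K, ((T'.filter fun t => R t k).card : ℝ)
        = ∑ t ∈ T', ((K.filter (R t)).card : ℝ) := by
      exact_mod_cast (Finset.sum_card_bipartiteAbove_eq_sum_card_bipartiteBelow
        (s := T') (t := K) (r := R)).symm
    have hlow : T'.card * δ ≤ ∑ k ∈ K, ((T'.filter fun t => R t k).card : ℝ) := by
      rw [hdc, ← nsmul_eq_mul]
      exact Finset.card_nsmul_le_sum _ _ _ fun t ht => h t (Finset.mem_filter.1 ht).1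
    obtain ⟨k, hk, hkle⟩ : ∃ k ∈ K,
        T'.card * δ / K.card ≤ ((T'.filter fun t => R t k).card : ℝ) := by
      apply Finset.exists_le_of_sum_le hK
      rw [Finset.sum_const, nsmul_eq_mul, mul_div_cancel₀ _ hKpos.ne']
      exact hlow
    refine ⟨insert k S, Finset.insert_subset hk hSK,
      (Finset.card_insert_le _ _).trans (by omega), ?_⟩
    have heq : (T.filter fun t => ∀ s ∈ insert k S, ¬ R t s) = T'.filter fun t => ¬ R t k := by
      ext t; simp [hT', Finset.mem_filter]; tauto
    have hsum : ((T'.filter fun t => R t k).card : ℝ) +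
        (T'.filter fun t => ¬ R t k).card = T'.card := by
      exact_mod_cast Finset.card_filter_add_card_filter_not (s := T') (fun t => R t k)
    rw [heq, pow_succ, ← mul_assoc]
    calc ((T'.filter fun t => ¬ R t k).card : ℝ) ≤ T'.card - T'.card * δ / K.card := by linarith
      _ = T'.card * (1 - δ / K.card) := by ring
      _ ≤ _ := by gcongr

open Classical in
/-- If every `t ∈ T` is related to at least `δ` elements of `K`, then a small family `S` meets
all of `T`: every `t ∈ T` belongs to `S` or is related to an element of `S ∩ K`. -/
theorem exists_small_hitting {β : Type*} [DecidableEq β] (K T : Finset β) (R : β → β → Prop)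
    (δ L : ℝ) (hδ : 0 < δ) (hL : 0 ≤ L)
    (h : ∀ t ∈ T, δ ≤ ((K.filter (R t)).card : ℝ)) :
    ∃ S ⊆ K ∪ T, (S.card : ℝ) ≤ K.card * L / δ + 1 + T.card * Real.exp (-L) ∧
      ∀ t ∈ T, t ∈ S ∨ ∃ s ∈ S, s ∈ K ∧ R t s := by
  rcases T.eq_empty_or_nonempty with rfl | ⟨t₀, ht₀⟩
  · exact ⟨∅, by simp, by simp; positivity, by simp⟩
  have hδK : δ ≤ K.card := (h t₀ ht₀).trans (by exact_mod_cast Finset.card_filter_le _ _)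
  have hKpos : (0 : ℝ) < K.card := hδ.trans_le hδK
  have hK : K.Nonempty := Finset.card_pos.1 (by exact_mod_cast hKpos)
  obtain ⟨S, hSK, hSm, hS⟩ := exists_hitting_of_steps K T R δ hδK hK h ⌈K.card * L / δ⌉₊
  refine ⟨S ∪ T.filter fun t => ∀ s ∈ S, ¬ R t s,
    Finset.union_subset_union hSK (Finset.filter_subset _ _), ?_, fun t ht => ?_⟩
  · have hpow : (1 - δ / K.card) ^ ⌈K.card * L / δ⌉₊ ≤ Real.exp (-L) := by
      calc (1 - δ / K.card) ^ ⌈K.card * L / δ⌉₊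
          ≤ (Real.exp (-(δ / K.card))) ^ ⌈K.card * L / δ⌉₊ := by
            apply pow_le_pow_left₀
            · rw [sub_nonneg, div_le_one hKpos]; exact hδK
            · have := Real.add_one_le_exp (-(δ / K.card)); linarith
        _ = Real.exp (⌈K.card * L / δ⌉₊ * (-(δ / K.card))) := by rw [Real.exp_nat_mul]
        _ ≤ Real.exp (-L) := by
            apply Real.exp_le_exp.2
            have h1 : K.card * L / δ * (δ / K.card) ≤ ⌈K.card * L / δ⌉₊ * (δ / K.card) := by
              gcongr; exact Nat.le_ceil _
            have h2 : K.card * L / δ * (δ / K.card) = L := by field_simp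
            linarith
    have hceil : (⌈K.card * L / δ⌉₊ : ℝ) ≤ K.card * L / δ + 1 :=
      (Nat.ceil_lt_add_one (by positivity)).le
    have hcu : ((S ∪ T.filter fun t => ∀ s ∈ S, ¬ R t s).card : ℝ)
        ≤ S.card + (T.filter fun t => ∀ s ∈ S, ¬ R t s).card := by
      exact_mod_cast Finset.card_union_le _ _
    have hSm' : (S.card : ℝ) ≤ ⌈K.card * L / δ⌉₊ := by exact_mod_cast hSm
    have := mul_le_mul_of_nonneg_left hpow (Nat.cast_nonneg (α := ℝ) T.card)
    linarith
  · by_cases hh : ∀ s ∈ S, ¬ R t s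
    · exact Or.inl (Finset.mem_union_right _ (Finset.mem_filter.2 ⟨ht, hh⟩))
    · push Not at hh
      obtain ⟨s, hs, hR⟩ := hh
      exact Or.inr ⟨s, Finset.mem_union_left _ hs, hSK hs, hR⟩

/-! ### Families of bounded Johnson degree are sparse -/

open Classical in
/-- A family of `r`-sets in which every member has at most `Δ` Johnson neighbours has density at
most `(r + Δ) / (r (n - r + 1))`. This is Cauchy–Schwarz for the number of members containing a
given `(r - 1)`-set. -/
theorem card_le_of_johnson_degree_le {α : Type*} [Fintype α] [DecidableEq α] (r : ℕ) (hr : 0 < r)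
    (hrn : r ≤ Fintype.card α) (U : Finset (Finset α)) (hU : ∀ X ∈ U, X.card = r) (Δ : ℝ)
    (hΔ0 : 0 ≤ Δ)
    (hdeg : ∀ X ∈ U, (johnsonDegree U X : ℝ) ≤ Δ) :
    (U.card : ℝ) * (r * (Fintype.card α - r + 1)) ≤ (Fintype.card α).choose r * (r + Δ) := by
  set n := Fintype.card α
  set P := Finset.powersetCard (r - 1) (Finset.univ : Finset α) with hP
  have hPcard : P.card = n.choose (r - 1) := by rw [hP, Finset.card_powersetCard, Finset.card_univ]
  -- the number of `(r - 1)`-subsets of a member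
  have hsub : ∀ X ∈ U, (P.filter fun Z => Z ⊆ X).card = r := by
    intro X hX
    have : P.filter (fun Z => Z ⊆ X) = Finset.powersetCard (r - 1) X := by
      ext Z; simp [hP, Finset.mem_powersetCard, and_comm]
    rw [this, Finset.card_powersetCard, hU X hX]
    obtain ⟨k, rfl⟩ : ∃ k, r = k + 1 := ⟨r - 1, by omega⟩
    simp
  have hsum1 : ∑ Z ∈ P, ((U.filter fun X => Z ⊆ X).card : ℝ) = U.card * r := by
    have := Finset.sum_card_bipartiteAbove_eq_sum_card_bipartiteBelow
      (s := P) (t := U) (r := fun Z X => Z ⊆ X)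
    have h2 : ∑ Z ∈ P, (U.filter fun X => Z ⊆ X).card = U.card * r := by
      refine this.trans ?_
      rw [← smul_eq_mul, ← Finset.sum_const]
      exact Finset.sum_congr rfl fun X hX => hsub X hX
    exact_mod_cast h2
  -- Distinct `r`-sets share at most one `(r - 1)`-set, and share one only if they are adjacent.
  have hpair : ∀ X ∈ U, ∑ Y ∈ U, ((P.filter fun Z => Z ⊆ X ∧ Z ⊆ Y).card : ℝ) ≤ r + Δ := by
    intro X hX
    have hone : ∀ Y ∈ U, Y ≠ X → ((P.filter fun Z => Z ⊆ X ∧ Z ⊆ Y).card : ℝ) ≤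
        if JohnsonAdj X Y then 1 else 0 := by
      intro Y hY hYX
      have hlt : (X ∩ Y).card < r := by
        rw [← hU X hX]
        apply Finset.card_lt_card
        refine ⟨Finset.inter_subset_left, fun hsub => hYX ?_⟩
        exact (Finset.eq_of_subset_of_card_le (fun a ha => (Finset.mem_inter.1 (hsub ha)).2)
          (by rw [hU X hX, hU Y hY])).symm
      have hZ : ∀ Z ∈ P.filter (fun Z => Z ⊆ X ∧ Z ⊆ Y), Z = X ∩ Y := by
        intro Z hZ
        simp only [hP, Finset.mem_filter, Finset.mem_powersetCard] at hZ
        exact Finset.eq_of_subset_of_card_le (Finset.subset_inter hZ.2.1 hZ.2.2) (by omega)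
      have hcard1 : (P.filter fun Z => Z ⊆ X ∧ Z ⊆ Y).card ≤ 1 :=
        Finset.card_le_one.2 fun a ha b hb => (hZ a ha).trans (hZ b hb).symm
      split_ifs with hadj
      · exact_mod_cast hcard1
      · have : P.filter (fun Z => Z ⊆ X ∧ Z ⊆ Y) = ∅ := by
          rw [Finset.eq_empty_iff_forall_notMem]
          intro Z hZm
          apply hadj
          have hZm' := hZm
          simp only [hP, Finset.mem_filter, Finset.mem_powersetCard] at hZm'
          obtain ⟨x, hx, hxX⟩ := Finset.exists_eq_insert_iff.2 ⟨hZm'.2.1, by rw [hU X hX]; omega⟩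
          obtain ⟨y, hy, hyY⟩ := Finset.exists_eq_insert_iff.2 ⟨hZm'.2.2, by rw [hU Y hY]; omega⟩
          subst hxX hyY
          exact JohnsonAdj.of_insert hx hy (by rintro rfl; exact hYX rfl)
        rw [this]; simp
    rw [← Finset.add_sum_erase _ _ hX]
    have h1 : ((P.filter fun Z => Z ⊆ X ∧ Z ⊆ X).card : ℝ) = r := by
      simp only [and_self]; exact_mod_cast hsub X hX
    have h2 : ∑ Y ∈ U.erase X, ((P.filter fun Z => Z ⊆ X ∧ Z ⊆ Y).card : ℝ) ≤ Δ := by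
      calc _ ≤ ∑ Y ∈ U.erase X, (if JohnsonAdj X Y then (1 : ℝ) else 0) :=
            Finset.sum_le_sum fun Y hY =>
              hone Y (Finset.mem_of_mem_erase hY) (Finset.ne_of_mem_erase hY)
        _ ≤ ∑ Y ∈ U, (if JohnsonAdj X Y then (1 : ℝ) else 0) :=
            Finset.sum_le_sum_of_subset_of_nonneg (Finset.erase_subset _ _)
              (fun _ _ _ => by split_ifs <;> norm_num)
        _ = (johnsonDegree U X : ℝ) := by simp
        _ ≤ Δ := hdeg X hX
    linarith
  have hsum2 : ∑ Z ∈ P, ((U.filter fun X => Z ⊆ X).card : ℝ) ^ 2 ≤ U.card * (r + Δ) := by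
    have hsq : ∀ Z ∈ P, ((U.filter fun X => Z ⊆ X).card : ℝ) ^ 2 =
        ∑ X ∈ U, ∑ Y ∈ U, if Z ⊆ X ∧ Z ⊆ Y then (1 : ℝ) else 0 := by
      intro Z _
      have : ((U.filter fun X => Z ⊆ X).card : ℝ) = ∑ X ∈ U, if Z ⊆ X then (1 : ℝ) else 0 := by simp
      rw [this, sq, Finset.sum_mul_sum]
      refine Finset.sum_congr rfl fun X _ => Finset.sum_congr rfl fun Y _ => ?_
      by_cases h1 : Z ⊆ X <;> by_cases h2 : Z ⊆ Y <;> simp [h1, h2]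
    rw [Finset.sum_congr rfl hsq, Finset.sum_comm]
    calc _ ≤ ∑ X ∈ U, (r + Δ) := by
          refine Finset.sum_le_sum fun X hX => ?_
          rw [Finset.sum_comm]
          refine le_trans (le_of_eq ?_) (hpair X hX)
          refine Finset.sum_congr rfl fun Y _ => ?_
          simp
      _ = _ := by rw [Finset.sum_const, nsmul_eq_mul]
  have hCS := sq_sum_le_card_mul_sum_sq (s := P)
    (f := fun Z => ((U.filter fun X => Z ⊆ X).card : ℝ))
  rw [hsum1, hPcard] at hCS
  have hch : (n.choose (r - 1) : ℝ) * (n - r + 1) = n.choose r * r := by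
    obtain ⟨k, rfl⟩ : ∃ k, r = k + 1 := ⟨r - 1, by omega⟩
    have := Nat.choose_succ_right_eq n k
    have hk : k ≤ n := by omega
    have h3 : (n.choose (k + 1) : ℝ) * ((k + 1 : ℕ) : ℝ) = n.choose k * ((n - k : ℕ) : ℝ) := by
      exact_mod_cast this
    rw [Nat.add_sub_cancel, h3, Nat.cast_sub hk]
    push_cast; ring
  rcases U.eq_empty_or_nonempty with rfl | ⟨X₀, hX₀⟩
  · simp; positivity
  have hUpos : (0 : ℝ) < U.card := by exact_mod_cast Finset.card_pos.2 ⟨X₀, hX₀⟩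
  have hrpos : (0 : ℝ) < r := by exact_mod_cast hr
  have hnr : (0 : ℝ) ≤ n - r + 1 := by
    have : (r : ℝ) ≤ n := by exact_mod_cast hrn
    linarith
  have h4 : (U.card * (r : ℝ)) ^ 2 ≤ n.choose (r - 1) * (U.card * (r + Δ)) :=
    hCS.trans (mul_le_mul_of_nonneg_left hsum2 (Nat.cast_nonneg _))
  have h5 : (U.card * (r : ℝ)) * ((U.card : ℝ) * (r * (n - r + 1))) ≤
      (U.card * (r : ℝ)) * (n.choose r * (r + Δ)) := by
    calc _ = (U.card * (r : ℝ)) ^ 2 * (n - r + 1) := by ring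
      _ ≤ n.choose (r - 1) * (U.card * (r + Δ)) * (n - r + 1) := by gcongr
      _ = (n.choose (r - 1) * (n - r + 1)) * (U.card * (r + Δ)) := by ring
      _ = _ := by rw [hch]; ring
  exact le_of_mul_le_mul_left h5 (by positivity)

/-! ### Sparse paving matroids from stable families -/

section SparsePaving
variable {n r : ℕ}

/-- Of two distinct `r`-sets containing a common `(r - 1)`-set, at most one lies in a stable
family. -/
theorem IsStableFamily.insert_notMem_or {α : Type*} [DecidableEq α] {r : ℕ}
    {I : Finset (Finset α)} (hI : IsStableFamily r I)
    {Z : Finset α} {x y : α} (hx : x ∉ Z) (hy : y ∉ Z) (hxy : x ≠ y) :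
    insert x Z ∉ I ∨ insert y Z ∉ I := by
  by_contra! h
  exact hI.2 _ h.1 _ h.2 (JohnsonAdj.of_insert hx hy hxy)

theorem IsStableFamily.erase_notMem_or {α : Type*} [DecidableEq α] {r : ℕ}
    {I : Finset (Finset α)} (hI : IsStableFamily r I)
    {W : Finset α} {x y : α} (hx : x ∈ W) (hy : y ∈ W) (hxy : x ≠ y) :
    W.erase x ∉ I ∨ W.erase y ∉ I := by
  by_contra! h
  exact hI.2 _ h.1 _ h.2 (JohnsonAdj.of_erase hx hy hxy)

/-- Every set of size less than `r` extends to an `r`-set outside a stable family. -/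
theorem IsStableFamily.exists_superset {I : Finset (Finset (Fin n))} (hI : IsStableFamily r I)
    (hrn : r < n) {Z : Finset (Fin n)} (hZ : Z.card < r) :
    ∃ B, Z ⊆ B ∧ B.card = r ∧ B ∉ I := by
  obtain ⟨Z', hZZ', hZ'⟩ := Finset.exists_superset_card_eq (s := Z) (n := r - 1) (by omega)
    (by rw [Fintype.card_fin]; omega)
  have hc : 1 < Z'ᶜ.card := by rw [Finset.card_compl, Fintype.card_fin]; omega
  obtain ⟨x, hx, y, hy, hxy⟩ := Finset.one_lt_card.1 hc
  rw [Finset.mem_compl] at hx hy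
  rcases hI.insert_notMem_or hx hy hxy with h | h
  · exact ⟨_, hZZ'.trans (Finset.subset_insert _ _), by
      rw [Finset.card_insert_of_notMem hx]; omega, h⟩
  · exact ⟨_, hZZ'.trans (Finset.subset_insert _ _), by
      rw [Finset.card_insert_of_notMem hy]; omega, h⟩

/-- Every set of size more than `r` contains an `r`-set outside a stable family. -/
theorem IsStableFamily.exists_subset {I : Finset (Finset (Fin n))} (hI : IsStableFamily r I)
    (hr : 0 < r) {W : Finset (Fin n)} (hW : r < W.card) :
    ∃ B ⊆ W, B.card = r ∧ B ∉ I := by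
  obtain ⟨W', hWW', hW'⟩ := Finset.exists_subset_card_eq (s := W) (n := r + 1) (by omega)
  obtain ⟨x, hx, y, hy, hxy⟩ := Finset.one_lt_card.1 (show 1 < W'.card by omega)
  rcases hI.erase_notMem_or hx hy hxy with h | h
  · exact ⟨_, (Finset.erase_subset _ _).trans hWW', by
      rw [Finset.card_erase_of_mem hx]; omega, h⟩
  · exact ⟨_, (Finset.erase_subset _ _).trans hWW', by
      rw [Finset.card_erase_of_mem hy]; omega, h⟩

/-- The matroid on `Fin n` whose bases are the `r`-sets outside a stable family `I`. The exchange
axiom holds because two of the candidate exchanges are adjacent in the Johnson graph. -/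
def sparsePavingOf (I : Finset (Finset (Fin n))) (hI : IsStableFamily r I) (hr : 0 < r)
    (hrn : r < n) : Matroid (Fin n) :=
  Matroid.ofIsBaseOfFinite (E := Set.univ) Set.finite_univ
    (fun B => ∃ F : Finset (Fin n), (F : Set (Fin n)) = B ∧ F.card = r ∧ F ∉ I)
    (by
      obtain ⟨B, -, h, h'⟩ := hI.exists_superset hrn (Z := ∅) (by simpa using hr)
      exact ⟨B, B, rfl, h, h'⟩)
    (by
      rintro _ _ ⟨X, rfl, hX, hXI⟩ ⟨Y, rfl, hY, hYI⟩ a ⟨haX, haY⟩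
      rw [Finset.mem_coe] at haX haY
      have hcard : (Y \ X).card = (X \ Y).card := by
        have h1 := Finset.card_sdiff_add_card_inter X Y
        have h2 := Finset.card_sdiff_add_card_inter Y X
        rw [Finset.inter_comm] at h2
        omega
      have hXYpos : 0 < (X \ Y).card := Finset.card_pos.2 ⟨a, Finset.mem_sdiff.2 ⟨haX, haY⟩⟩
      have key : ∀ b, b ∉ X → b ∈ Y → insert b (X.erase a) ∉ I →
          ∃ b ∈ (Y : Set (Fin n)) \ X, ∃ F : Finset (Fin n),
            (F : Set (Fin n)) = insert b ((X : Set (Fin n)) \ {a}) ∧ F.card = r ∧ F ∉ I := by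
        intro b hbX hbY hb
        exact ⟨b, ⟨hbY, hbX⟩, insert b (X.erase a), by simp, by
          rw [card_insert_erase haX hbX, hX], hb⟩
      by_cases h1 : (Y \ X).card = 1
      · -- The only possible exchange yields `Y` itself.
        obtain ⟨b, hb⟩ := Finset.card_eq_one.1 h1
        obtain ⟨a', ha'⟩ := Finset.card_eq_one.1 (hcard ▸ h1)
        have haa : a = a' := by
          have : a ∈ X \ Y := Finset.mem_sdiff.2 ⟨haX, haY⟩
          simpa [ha'] using this
        subst haa
        have hbm : b ∈ Y \ X := by simp [hb]
        rw [Finset.mem_sdiff] at hbm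
        refine key b hbm.2 hbm.1 ?_
        have : insert b (X.erase a) = Y := by
          ext c
          have hc1 := Finset.ext_iff.1 hb c
          have hc2 := Finset.ext_iff.1 ha' c
          simp only [Finset.mem_sdiff, Finset.mem_singleton] at hc1 hc2
          simp only [Finset.mem_insert, Finset.mem_erase]
          grind
        rwa [this]
      · -- The sets `X - a + b` and `X - a + c` are adjacent, so one of them is outside `I`.
        obtain ⟨b, hb, c, hc, hbc⟩ := Finset.one_lt_card.1 (show 1 < (Y \ X).card by omega)
        rw [Finset.mem_sdiff] at hb hc
        rcases hI.insert_notMem_or (Z := X.erase a) (fun h => hb.2 (Finset.mem_of_mem_erase h))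
          (fun h => hc.2 (Finset.mem_of_mem_erase h)) hbc with h | h
        · exact key b hb.2 hb.1 h
        · exact key c hc.2 hc.1 h)
    (fun _ _ => Set.subset_univ _)

variable {I : Finset (Finset (Fin n))} (hI : IsStableFamily r I) (hr : 0 < r) (hrn : r < n)

theorem sparsePavingOf_ground : (sparsePavingOf I hI hr hrn).E = Set.univ := rfl

theorem sparsePavingOf_isBase_iff (B : Finset (Fin n)) :
    (sparsePavingOf I hI hr hrn).IsBase B ↔ B.card = r ∧ B ∉ I := by
  change (∃ F : Finset (Fin n), (F : Set (Fin n)) = B ∧ F.card = r ∧ F ∉ I) ↔ _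
  constructor
  · rintro ⟨F, hF, h⟩
    rwa [Finset.coe_injective hF] at h
  · exact fun h => ⟨B, rfl, h⟩

theorem sparsePavingOf_eRank : (sparsePavingOf I hI hr hrn).eRank = r := by
  obtain ⟨B, -, hB⟩ := hI.exists_superset hrn (Z := ∅) (by simpa using hr)
  rw [← ((sparsePavingOf_isBase_iff hI hr hrn B).2 hB).encard_eq_eRank,
    Set.encard_coe_eq_coe_finsetCard, hB.1]

theorem sparsePavingOf_isPaving : (sparsePavingOf I hI hr hrn).IsPaving := by
  classical
  intro C hC
  rw [sparsePavingOf_eRank hI hr hrn]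
  by_contra! hlt
  lift C to Finset (Fin n) using C.toFinite
  rw [Set.encard_coe_eq_coe_finsetCard, Nat.cast_lt] at hlt
  obtain ⟨B, hCB, hB⟩ := hI.exists_superset hrn hlt
  exact hC.not_indep (((sparsePavingOf_isBase_iff hI hr hrn B).2 hB).indep.subset (by simpa))

theorem sparsePavingOf_dual_isPaving : (sparsePavingOf I hI hr hrn)✶.IsPaving := by
  classical
  intro C hC
  lift C to Finset (Fin n) using C.toFinite
  by_contra! hlt
  have hsum := (sparsePavingOf I hI hr hrn).eRank_add_eRank_dual
  rw [sparsePavingOf_eRank hI hr hrn, sparsePavingOf_ground, Set.encard_univ,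
    ENat.card_eq_coe_fintype_card, Fintype.card_fin] at hsum
  rw [Set.encard_coe_eq_coe_finsetCard] at hlt
  have hlt' : r + C.card < n := by
    have : (r : ℕ∞) + C.card < n := by
      rw [← hsum]
      exact (ENat.add_lt_add_iff_left (ENat.natCast_ne_top r)).2 hlt
    exact_mod_cast this
  obtain ⟨B, hBC, hB⟩ := hI.exists_subset hr (W := Cᶜ) (by
    rw [Finset.card_compl, Fintype.card_fin]; omega)
  have hbase := (sparsePavingOf_isBase_iff hI hr hrn B).2 hB
  apply hC.not_indep
  refine hbase.compl_isBase_dual.indep.subset ?_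
  intro c hc
  refine ⟨trivial, fun hcB => ?_⟩
  have := hBC hcB
  simp at this
  exact this hc

end SparsePaving

open Classical in
/-- Stable families of the Johnson graph inject into sparse paving matroids. -/
theorem card_isStableFamily_le_numSparsePaving {n r : ℕ} (hr : 0 < r) (hrn : r < n) :
    (Finset.univ.filter fun I : Finset (Finset (Fin n)) => IsStableFamily r I).card
      ≤ numSparsePaving n := by
  have hfin : Finite (Matroid (Fin n)) := finite_matroid_of_finite
  rw [numSparsePaving, ← Set.ncard_coe_finset]
  refine Set.ncard_le_ncard_of_injOn
    (fun I => if hI : IsStableFamily r I then sparsePavingOf I hI hr hrn else Matroid.emptyOn _)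
    ?_ ?_ (Set.toFinite _)
  · intro I hI
    have hI' : IsStableFamily r I := by simpa using hI
    simp only [hI', dif_pos]
    exact ⟨sparsePavingOf_ground hI' hr hrn, sparsePavingOf_isPaving hI' hr hrn,
      sparsePavingOf_dual_isPaving hI' hr hrn⟩
  · intro I hI J hJ hIJ
    have hI' : IsStableFamily r I := by simpa using hI
    have hJ' : IsStableFamily r J := by simpa using hJ
    simp only [hI', hJ', dif_pos] at hIJ
    ext B
    by_cases hB : B.card = r
    · have h1 := sparsePavingOf_isBase_iff hI' hr hrn B
      rw [hIJ, sparsePavingOf_isBase_iff hJ' hr hrn B] at h1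
      tauto
    · exact ⟨fun h => absurd (hI'.1 B h) hB, fun h => absurd (hJ'.1 B h) hB⟩

/-- Splitting the middle layer by the sum of the elements modulo `n` yields a stable family of
size at least `n.choose (n / 2) / n`; all of its subfamilies are stable as well. -/
theorem two_pow_le_numSparsePaving {n : ℕ} (hn : 2 ≤ n) :
    ∃ k : ℕ, n.choose (n / 2) ≤ n * k ∧ 2 ^ k ≤ numSparsePaving n := by
  classical
  have : NeZero n := ⟨by omega⟩
  set r := n / 2
  set P := Finset.powersetCard r (Finset.univ : Finset (Fin n)) with hP
  obtain ⟨c, -, hc⟩ := Finset.exists_le_card_fiber_of_nsmul_le_card_of_maps_to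
    (s := P) (t := (Finset.univ : Finset (Fin n))) (f := fun X => ∑ x ∈ X, x)
    (b := (P.card : ℚ) / n) (fun _ _ => Finset.mem_univ _) (by simp)
    (by
      rw [Finset.card_univ, Fintype.card_fin, nsmul_eq_mul]
      have : (n : ℚ) ≠ 0 := by exact_mod_cast (by omega : n ≠ 0)
      rw [mul_div_cancel₀ _ this])
  set J := P.filter fun X => ∑ x ∈ X, x = c with hJ
  have hstab : IsStableFamily r J := by
    refine ⟨fun X hX => ?_, fun X hX Y hY hadj => ?_⟩
    · simpa [hJ, hP] using (Finset.mem_filter.1 hX).1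
    · -- Exchanging `x` for `y` changes the sum by `y - x`, which is nonzero modulo `n`.
      obtain ⟨x, hx, y, hy, rfl⟩ := hadj
      have h1 := (Finset.mem_filter.1 hX).2
      have h2 := (Finset.mem_filter.1 hY).2
      rw [Finset.sum_insert (fun h => hy (Finset.mem_of_mem_erase h))] at h2
      rw [← Finset.add_sum_erase _ _ hx, ← h2] at h1
      exact hy (add_right_cancel h1 ▸ hx)
  refine ⟨J.card, ?_, ?_⟩
  · have hPc : P.card = n.choose r := by rw [hP, Finset.card_powersetCard, Finset.card_univ,
      Fintype.card_fin]
    rw [div_le_iff₀ (by exact_mod_cast (by omega : 0 < n)), hPc] at hc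
    rw [mul_comm]
    exact_mod_cast hc
  · rw [← Finset.card_powerset]
    refine le_trans (Finset.card_le_card fun I hI => ?_)
      (card_isStableFamily_le_numSparsePaving (r := r) (n := n) (by omega) (by omega))
    simpa using hstab.subset (Finset.mem_powerset.1 hI)

/-! ### Dependent `r`-sets of a matroid of rank `r` -/

section Nonbases
variable {α : Type*} {M : Matroid α} {r : ℕ}

theorem indep_of_closure_eq_ground (hE : M.E = Set.univ) (hr : M.eRank = r)
    {X : Finset α} (hX : X.card = r) (hcl : M.closure X = M.E) : M.Indep (X : Set α) := by
  have hsp : M.Spanning (X : Set α) :=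
    (Matroid.spanning_iff_closure_eq (by rw [hE]; exact Set.subset_univ _)).2 hcl
  rw [Matroid.indep_iff_eRk_eq_encard_of_finite X.finite_toSet, hsp.eRk_eq, hr,
    Set.encard_coe_eq_coe_finsetCard, hX]

theorem closure_eq_ground_of_indep (hr : M.eRank = r)
    {X : Finset α} (hX : X.card = r) (hi : M.Indep (X : Set α)) : M.closure X = M.E := by
  refine (hi.isBase_of_eRk_ge X.finite_toSet ?_).closure_eq
  rw [hr, hi.eRk_eq_encard, Set.encard_coe_eq_coe_finsetCard, hX]

variable [DecidableEq α]

/-- If a dependent set becomes independent after deleting some element, it contains only one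
circuit, so deleting any element of that circuit makes it independent. -/
theorem indep_erase_of_mem_circuit {X C : Finset α} {x w : α}
    (hx : x ∈ X) (hXx : M.Indep (X.erase x : Set α)) (hC : M.IsCircuit (C : Set α)) (hCX : C ⊆ X)
    (hw : w ∈ C) : M.Indep (X.erase w : Set α) := by
  have hxC : x ∈ C := by
    by_contra hxC
    exact hC.not_indep (hXx.subset (by exact_mod_cast Finset.subset_erase.2 ⟨hCX, hxC⟩))
  have hCi : (C : Set α) ⊆ insert x (X.erase x : Set α) := by
    rw [Finset.coe_erase, Set.insert_sdiff_singleton, Set.insert_eq_of_mem (by exact_mod_cast hx)]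
    exact_mod_cast hCX
  have hfund := hC.eq_fundCircuit_of_subset hXx hCi
  have hxcl : x ∈ M.closure (X.erase x : Set α) := by
    refine M.closure_subset_closure ?_ (hC.mem_closure_sdiff_singleton_of_mem (e := x) hxC)
    rw [Finset.coe_erase]
    exact Set.sdiff_subset_sdiff_left (by exact_mod_cast hCX)
  have hwf : w ∈ M.fundCircuit x (X.erase x : Set α) := hfund ▸ (by exact_mod_cast hw)
  rw [hXx.mem_fundCircuit_iff hxcl (by simp)] at hwf
  rw [Finset.coe_erase, Set.insert_sdiff_singleton, Set.insert_eq_of_mem (by exact_mod_cast hx)] at hwf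
  rwa [Finset.coe_erase]

theorem indep_insert_of_notMem_closure (hE : M.E = Set.univ) {Z : Finset α} {z : α}
    (hZ : M.Indep (Z : Set α)) (hz : z ∉ M.closure Z) : M.Indep (insert z Z : Finset α) := by
  rw [Finset.coe_insert]
  exact ((hZ.notMem_closure_iff (by rw [hE]; trivial)).1 hz).1

/-- Dependent Johnson neighbours of a set of nullity one are covered by its circuit or by its
closure. -/
theorem circuit_subset_or_subset_closure (hE : M.E = Set.univ) {X C Y : Finset α} {x₀ : α}
    (hx₀ : x₀ ∈ X) (hXx : M.Indep (X.erase x₀ : Set α)) (hC : M.IsCircuit (C : Set α)) (hCX : C ⊆ X)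
    (hadj : JohnsonAdj X Y) (hY : ¬ M.Indep (Y : Set α)) :
    C ⊆ Y ∨ (Y : Set α) ⊆ M.closure X := by
  obtain ⟨x, hx, y, hy, rfl⟩ := hadj
  by_cases hxC : x ∈ C
  · right
    have hi := indep_erase_of_mem_circuit hx₀ hXx hC hCX hxC
    have hXE : (X : Set α) ⊆ M.E := by rw [hE]; exact Set.subset_univ _
    have hsub : (X.erase x : Set α) ⊆ X := by exact_mod_cast Finset.erase_subset x X
    have hycl : y ∈ M.closure X := by
      by_contra hycl
      exact hY (indep_insert_of_notMem_closure hE hi fun h => hycl (M.closure_subset_closure hsub h))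
    rw [Finset.coe_insert]
    exact Set.insert_subset hycl (hsub.trans (M.subset_closure _ hXE))
  · exact Or.inl ((Finset.subset_erase.2 ⟨hCX, hxC⟩).trans (Finset.subset_insert _ _))

/-- A set all of whose one-element deletions are dependent has only dependent neighbours. -/
theorem not_indep_of_johnsonAdj {X Y : Finset α}
    (hX : ∀ x ∈ X, ¬ M.Indep (X.erase x : Set α)) (hadj : JohnsonAdj X Y) :
    ¬ M.Indep (Y : Set α) := by
  obtain ⟨x, hx, y, hy, rfl⟩ := hadj
  intro h
  exact hX x hx (h.subset (by exact_mod_cast Finset.subset_insert _ _))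

/-- If `X` leaves a flat `H` only in the element `x`, then `x` is a coloop of `X`, and the
dependence of `X` is that of `X - x`. -/
theorem not_indep_exchange_of_flat (hE : M.E = Set.univ) {X H : Finset α} {x y : α}
    (hH : M.closure H = H) (hXH : X \ H = {x})
    (hX : ¬ M.Indep (X : Set α)) : ¬ M.Indep (insert y (X.erase x) : Finset α) := by
  intro h
  have hxm : x ∈ X \ H := by rw [hXH]; simp
  rw [Finset.mem_sdiff] at hxm
  have hZ : M.Indep (X.erase x : Set α) :=
    h.subset (by exact_mod_cast Finset.subset_insert _ _)
  have hZH : (X.erase x : Set α) ⊆ H := by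
    have : X.erase x ⊆ H := by
      intro a ha
      rw [Finset.mem_erase] at ha
      by_contra haH
      have : a ∈ X \ H := Finset.mem_sdiff.2 ⟨ha.2, haH⟩
      rw [hXH, Finset.mem_singleton] at this
      exact ha.1 this
    exact_mod_cast this
  apply hX
  have := indep_insert_of_notMem_closure hE hZ (z := x) fun hx => hxm.2 (by
    have := M.closure_subset_closure hZH hx
    rw [hH] at this
    exact_mod_cast this)
  rwa [Finset.insert_erase hxm.1] at this

/-- If a circuit `C` leaves `X` only in the element `y`, then `y` lies in the closure of `X`, so no
exchange `X - x + y` can span more than `X`. -/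
theorem not_indep_exchange_of_circuit (hE : M.E = Set.univ) (hr : M.eRank = r) {X C : Finset α}
    {x y : α} (hC : M.IsCircuit (C : Set α)) (hCX : C \ X = {y}) (hx : x ∈ X)
    (hXr : X.card = r) (hX : ¬ M.Indep (X : Set α)) :
    ¬ M.Indep (insert y (X.erase x) : Finset α) := by
  intro h
  have hym : y ∈ C \ X := by rw [hCX]; simp
  rw [Finset.mem_sdiff] at hym
  have hCi : ∀ a ∈ C, a = y ∨ a ∈ X := by
    intro a ha
    by_contra! hcon
    have : a ∈ C \ X := Finset.mem_sdiff.2 ⟨ha, hcon.2⟩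
    rw [hCX, Finset.mem_singleton] at this
    exact hcon.1 this
  apply hX
  apply indep_of_closure_eq_ground hE hr hXr
  have hYsp := closure_eq_ground_of_indep hr (by rw [card_insert_erase hx hym.2, hXr]) h
  have hXE : (X : Set α) ⊆ M.E := by rw [hE]; exact Set.subset_univ _
  have hycl : y ∈ M.closure X := by
    refine M.closure_subset_closure ?_ (hC.mem_closure_sdiff_singleton_of_mem (e := y) hym.1)
    rintro a ⟨ha, hay⟩
    rcases hCi a ha with rfl | haX
    · exact absurd rfl hay
    · exact haX
  have hsub : ((insert y (X.erase x) : Finset α) : Set α) ⊆ M.closure X := by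
    rw [Finset.coe_insert]
    refine Set.insert_subset hycl (Set.Subset.trans ?_ (M.subset_closure _ hXE))
    exact_mod_cast Finset.erase_subset x X
  have := M.closure_subset_closure_of_subset_closure hsub
  rw [hYsp] at this
  exact (M.closure_subset_ground _).antisymm this

end Nonbases

/-! ### Describing a matroid by a stable family and a few sets -/

section Description
open Classical

variable {α : Type*} [Fintype α]

/-- The dependent `r`-sets of a matroid; when the rank is `r` these are the `r`-sets that are
not bases. -/
noncomputable def nonbases (M : Matroid α) (r : ℕ) : Finset (Finset α) :=
  (Finset.powersetCard r Finset.univ).filter fun X => ¬ M.Indep (X : Set α)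

/-- The closure of a finite set, as a finite set. -/
noncomputable def closureFinset (M : Matroid α) (X : Finset α) : Finset α :=
  Finset.univ.filter fun a => a ∈ M.closure X

variable {M : Matroid α} {r : ℕ}

theorem mem_nonbases {X : Finset α} :
    X ∈ nonbases M r ↔ X.card = r ∧ ¬ M.Indep (X : Set α) := by
  simp [nonbases, Finset.mem_powersetCard]

theorem mem_closureFinset {X : Finset α} {a : α} : a ∈ closureFinset M X ↔ a ∈ M.closure X := by
  simp [closureFinset]

theorem coe_closureFinset (X : Finset α) : (closureFinset M X : Set α) = M.closure X := by
  ext a; simp [closureFinset]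

variable [DecidableEq α]

/-- An `r`-set is covered by lists `𝒞` of circuits, `ℋ` of non-spanning flats and `𝒳` of `r`-sets
of nullity at least two if the lists reveal that it is dependent: it contains a member of `𝒞`,
lies in a member of `ℋ`, or equals or is adjacent to a member of `𝒳`. -/
def IsCovered (𝒞 ℋ 𝒳 : Finset (Finset α)) (Y : Finset α) : Prop :=
  (∃ C ∈ 𝒞, C ⊆ Y) ∨ (∃ H ∈ ℋ, Y ⊆ H) ∨ ∃ X ∈ 𝒳, Y = X ∨ JohnsonAdj X Y

/-- An exchange of `x ∈ X` for `y ∉ X` that preserves dependence, as witnessed by a flat in `ℋ` or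
by a circuit in `𝒞`. -/
def IsForcedExchange (𝒞 ℋ : Finset (Finset α)) (X Y : Finset α) : Prop :=
  ∃ x ∈ X, ∃ y ∉ X, Y = insert y (X.erase x) ∧
    ((∃ H ∈ ℋ, X \ H = {x}) ∨ ∃ C ∈ 𝒞, C \ X = {y})

/-- The family of `r`-sets reconstructed from lists `𝒞`, `ℋ`, `𝒳` and a stable family `I`. -/
noncomputable def decode (r : ℕ) (𝒞 ℋ 𝒳 I : Finset (Finset α)) : Finset (Finset α) :=
  (Finset.powersetCard r Finset.univ).filter fun Y =>
    IsCovered 𝒞 ℋ 𝒳 Y ∨ Y ∈ I ∨ ∃ X ∈ I, IsForcedExchange 𝒞 ℋ X Y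

/-- Lists of circuits, of non-spanning flats and of sets of nullity at least two, together with
dependent `r`-sets, decode to dependent sets only. -/
theorem decode_subset_nonbases (hE : M.E = Set.univ) (hr : M.eRank = r)
    {𝒞 ℋ 𝒳 I : Finset (Finset α)} (h𝒞 : ∀ C ∈ 𝒞, M.IsCircuit (C : Set α))
    (hℋ : ∀ H ∈ ℋ, M.closure H = H ∧ (H : Set α) ≠ M.E)
    (h𝒳 : ∀ X ∈ 𝒳, X ∈ nonbases M r ∧ ∀ x ∈ X, ¬ M.Indep (X.erase x : Set α))
    (hI : I ⊆ nonbases M r) : decode r 𝒞 ℋ 𝒳 I ⊆ nonbases M r := by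
  intro Y hY
  simp only [decode, Finset.mem_filter, Finset.mem_powersetCard_univ] at hY
  obtain ⟨hYr, hY⟩ := hY
  refine mem_nonbases.2 ⟨hYr, fun hi => ?_⟩
  rcases hY with (⟨C, hC, hCY⟩ | ⟨H, hH, hYH⟩ | ⟨X, hX, rfl | hadj⟩) | hYI | ⟨X, hX, hf⟩
  · exact (h𝒞 C hC).not_indep (hi.subset (by exact_mod_cast hCY))
  · obtain ⟨hcl, hne⟩ := hℋ H hH
    apply hne
    have h1 := closure_eq_ground_of_indep hr hYr hi
    have h2 := M.closure_subset_closure (show (Y : Set α) ⊆ H by exact_mod_cast hYH)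
    rw [h1, hcl] at h2
    exact Set.Subset.antisymm (by rw [hE]; exact Set.subset_univ _) h2
  · exact (mem_nonbases.1 (h𝒳 _ hX).1).2 hi
  · exact not_indep_of_johnsonAdj (h𝒳 X hX).2 hadj hi
  · exact (mem_nonbases.1 (hI hYI)).2 hi
  · obtain ⟨x, hx, y, hy, rfl, ⟨H, hH, hXH⟩ | ⟨C, hC, hCX⟩⟩ := hf
    · exact not_indep_exchange_of_flat hE (hℋ H hH).1 hXH (mem_nonbases.1 (hI hX)).2 hi
    · exact not_indep_exchange_of_circuit hE hr (h𝒞 C hC) hCX hx (mem_nonbases.1 (hI hX)).1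
        (mem_nonbases.1 (hI hX)).2 hi

end Description

/-! ### Recovering the dependent sets -/

section Description
open Classical

variable {α : Type*} [Fintype α] {M : Matroid α} {r : ℕ}

theorem exists_circuit_subset (hE : M.E = Set.univ) {X : Finset α} (hX : X ∈ nonbases M r) :
    ∃ C ⊆ X, M.IsCircuit (C : Set α) := by
  have hdep : M.Dep (X : Set α) := ⟨(mem_nonbases.1 hX).2, by rw [hE]; exact Set.subset_univ _⟩
  obtain ⟨C, hCX, hC⟩ := hdep.exists_isCircuit_subset
  lift C to Finset α using C.toFinite
  exact ⟨C, by exact_mod_cast hCX, hC⟩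

theorem subset_closureFinset (hE : M.E = Set.univ) (X : Finset α) : X ⊆ closureFinset M X := by
  intro a ha
  exact mem_closureFinset.2 (M.mem_closure_of_mem (by exact_mod_cast ha)
    (by rw [hE]; exact Set.subset_univ _))

theorem closureFinset_ne_ground (hE : M.E = Set.univ) (hr : M.eRank = r) {X : Finset α}
    (hX : X ∈ nonbases M r) : M.closure X ≠ M.E := fun h =>
  (mem_nonbases.1 hX).2 (indep_of_closure_eq_ground hE hr (mem_nonbases.1 hX).1 h)

theorem mem_nonbases_of_subset_closure (hE : M.E = Set.univ) (hr : M.eRank = r) {X Y : Finset α}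
    (hX : X ∈ nonbases M r) (hY : Y.card = r) (h : (Y : Set α) ⊆ M.closure X) :
    Y ∈ nonbases M r := by
  refine mem_nonbases.2 ⟨hY, fun hi => closureFinset_ne_ground hE hr hX ?_⟩
  have := M.closure_subset_closure_of_subset_closure h
  rw [closure_eq_ground_of_indep hr hY hi] at this
  exact (M.closure_subset_ground _).antisymm this

variable [DecidableEq α]

/-- The dependent `r`-sets of nullity one: some one-element deletion is independent. -/
noncomputable def nullityOne (M : Matroid α) (r : ℕ) : Finset (Finset α) :=
  (nonbases M r).filter fun X => ∃ x ∈ X, M.Indep (X.erase x : Set α)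

/-- A large closure gives many dependent neighbours. -/
theorem card_closure_le_degree (hE : M.E = Set.univ) (hr : M.eRank = r) {X : Finset α}
    (hX : X ∈ nonbases M r) :
    r * ((closureFinset M X).card - r) ≤ johnsonDegree (nonbases M r) X := by
  have hXr := (mem_nonbases.1 hX).1
  have := card_mul_card_le_johnson_degree X X (closureFinset M X \ X) (nonbases M r)
    Finset.Subset.rfl (fun y hy => (Finset.mem_sdiff.1 hy).2) (fun x hx y hy => by
      rw [Finset.mem_sdiff, mem_closureFinset] at hy
      refine mem_nonbases_of_subset_closure hE hr hX ((card_insert_erase hx hy.2).trans hXr) ?_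
      rw [Finset.coe_insert]
      refine Set.insert_subset hy.1 (Set.Subset.trans ?_ (M.subset_closure _ (by
        rw [hE]; exact Set.subset_univ _)))
      exact_mod_cast Finset.erase_subset x X)
  rwa [Finset.card_sdiff_of_subset (subset_closureFinset hE X), hXr] at this

/-- A small circuit gives many dependent neighbours. -/
theorem card_sub_circuit_le_degree {X C : Finset α}
    (hX : X ∈ nonbases M r) (hC : M.IsCircuit (C : Set α)) (hCX : C ⊆ X) :
    (r - C.card) * (Fintype.card α - r) ≤ johnsonDegree (nonbases M r) X := by
  have hXr := (mem_nonbases.1 hX).1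
  have := card_mul_card_le_johnson_degree X (X \ C) Xᶜ (nonbases M r)
    Finset.sdiff_subset (fun y hy => Finset.mem_compl.1 hy) (fun x hx y hy => by
      rw [Finset.mem_sdiff] at hx
      rw [Finset.mem_compl] at hy
      refine mem_nonbases.2 ⟨(card_insert_erase hx.1 hy).trans hXr, fun hi => hC.not_indep ?_⟩
      refine hi.subset ?_
      exact_mod_cast (Finset.subset_erase.2 ⟨hCX, hx.2⟩).trans (Finset.subset_insert _ _))
  rwa [Finset.card_sdiff_of_subset hCX, hXr, Finset.card_compl, hXr] at this

/-- All Johnson neighbours of a dependent set of nullity at least two are dependent. -/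
theorem card_mul_le_degree_of_notMem_nullityOne {X : Finset α}
    (hX : X ∈ nonbases M r) (hX1 : X ∉ nullityOne M r) :
    r * (Fintype.card α - r) ≤ johnsonDegree (nonbases M r) X := by
  have hXr := (mem_nonbases.1 hX).1
  have := card_mul_card_le_johnson_degree X X Xᶜ (nonbases M r)
    Finset.Subset.rfl (fun y hy => Finset.mem_compl.1 hy) (fun x hx y hy => by
      rw [Finset.mem_compl] at hy
      refine mem_nonbases.2 ⟨(card_insert_erase hx hy).trans hXr, ?_⟩
      refine not_indep_of_johnsonAdj (X := X) (fun x hx hi => hX1 ?_) ⟨x, hx, y, hy, rfl⟩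
      exact Finset.mem_filter.2 ⟨hX, x, hx, hi⟩)
  rwa [Finset.card_compl, hXr] at this

/-- Two adjacent dependent sets `X`, `Y`, with `X` of nullity one, lie in a clique of the Johnson
graph that contains many neighbours of `X` of nullity one. If `X` is not covered and has few neighbours among the uncovered sets, some
member of that clique is covered, and the flat or circuit covering it witnesses that the
exchange leading from `X` to `Y` is forced. -/
theorem isForcedExchange_of_johnsonAdj (hE : M.E = Set.univ) (hr : M.eRank = r)
    {𝒞 ℋ U : Finset (Finset α)} {X Y C : Finset α} {δ : ℝ}
    (h𝒞 : ∀ C ∈ 𝒞, M.IsCircuit (C : Set α)) (hℋ : ∀ H ∈ ℋ, M.closure H = H)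
    (hX : X ∈ nullityOne M r) (hY : Y ∈ nonbases M r) (hadj : JohnsonAdj X Y)
    (hC : M.IsCircuit (C : Set α)) (hCX : C ⊆ X)
    (hX𝒞 : ∀ C ∈ 𝒞, ¬ C ⊆ X) (hXℋ : ∀ H ∈ ℋ, ¬ X ⊆ H)
    (hU : ∀ X' ∈ nullityOne M r, X' ∉ U → (∃ C ∈ 𝒞, C ⊆ X') ∨ ∃ H ∈ ℋ, X' ⊆ H)
    (hdeg : (johnsonDegree U X : ℝ) < δ)
    (hcl : δ ≤ Fintype.card α - (closureFinset M X).card) (hCcard : δ ≤ C.card) :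
    IsForcedExchange 𝒞 ℋ X Y := by
  obtain ⟨hXK, x₀, hx₀, hXx₀⟩ := Finset.mem_filter.1 hX
  have hXr := (mem_nonbases.1 hXK).1
  have hXE : (X : Set α) ⊆ M.E := by rw [hE]; exact Set.subset_univ _
  obtain ⟨x, hx, y, hy, rfl⟩ := hadj
  refine ⟨x, hx, y, hy, rfl, ?_⟩
  have hZX : (X.erase x : Set α) ⊆ X := by exact_mod_cast Finset.erase_subset x X
  by_cases hZ : M.Indep (X.erase x : Set α)
  · -- `X - x` is independent, so `y` lies in its closure, and the sets `X - z + y` with `z ∈ C` all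
    -- have the same closure as `X`.
    right
    have hyZ : y ∈ M.closure (X.erase x : Set α) := by
      by_contra hyZ
      exact (mem_nonbases.1 hY).2 (indep_insert_of_notMem_closure hE hZ hyZ)
    have hycl := M.closure_subset_closure hZX hyZ
    have hone : ∀ z ∈ C, insert y (X.erase z) ∈ nullityOne M r := by
      intro z hz
      refine Finset.mem_filter.2 ⟨mem_nonbases_of_subset_closure hE hr hXK
        ((card_insert_erase (hCX hz) hy).trans hXr) ?_, y, Finset.mem_insert_self _ _, ?_⟩
      · rw [Finset.coe_insert]
        refine Set.insert_subset hycl (Set.Subset.trans ?_ (M.subset_closure _ hXE))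
        exact_mod_cast Finset.erase_subset z X
      · rw [Finset.erase_insert (fun h => hy (Finset.mem_of_mem_erase h))]
        exact indep_erase_of_mem_circuit hx₀ hXx₀ hC hCX hz
    obtain ⟨z, hz, hzU⟩ : ∃ z ∈ C, insert y (X.erase z) ∉ U := by
      by_contra! hcon
      have := card_mul_card_le_johnson_degree X C {y} U hCX (by simpa using hy)
        (fun z hz y' hy' => by rw [Finset.mem_singleton.1 hy']; exact hcon z hz)
      rw [Finset.card_singleton, mul_one] at this
      have : (C.card : ℝ) ≤ (johnsonDegree U X : ℝ) := by exact_mod_cast this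
      linarith
    rcases hU _ (hone z hz) hzU with ⟨C', hC', hsub⟩ | ⟨H, hH, hsub⟩
    · refine ⟨C', hC', Finset.eq_singleton_iff_nonempty_unique_mem.2
        ⟨Finset.sdiff_nonempty.2 (hX𝒞 C' hC'), fun a ha => ?_⟩⟩
      rw [Finset.mem_sdiff] at ha
      rcases Finset.mem_insert.1 (hsub ha.1) with h | h
      · exact h
      · exact absurd (Finset.mem_of_mem_erase h) ha.2
    · refine absurd ?_ (hXℋ H hH)
      have hzH : z ∈ H := by
        have h1 : z ∈ M.closure (X.erase z : Set α) := by
          refine M.closure_subset_closure ?_ (hC.mem_closure_sdiff_singleton_of_mem (e := z) hz)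
          rw [Finset.coe_erase]
          exact Set.sdiff_subset_sdiff_left (by exact_mod_cast hCX)
        have h2 : (X.erase z : Set α) ⊆ H := by
          exact_mod_cast (Finset.subset_insert _ _).trans hsub
        have h3 := M.closure_subset_closure h2 h1
        rw [hℋ H hH] at h3
        exact_mod_cast h3
      intro a ha
      by_cases haz : a = z
      · exact haz ▸ hzH
      · exact hsub (Finset.mem_insert_of_mem (Finset.mem_erase.2 ⟨haz, ha⟩))
  · -- `X - x` is dependent, and the sets `X - x + z` with `z` outside the closure of `X` share a
    -- circuit with `X`.
    left
    obtain ⟨C₁, hC₁Z, hC₁⟩ : ∃ C₁ ⊆ X.erase x, M.IsCircuit (C₁ : Set α) :=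
      exists_circuit_subset (r := (X.erase x).card) hE (mem_nonbases.2 ⟨rfl, hZ⟩)
    obtain ⟨w, hw⟩ := hC₁.nonempty
    have hwC₁ : w ∈ C₁ := by exact_mod_cast hw
    have hone : ∀ z ∉ closureFinset M X, insert z (X.erase x) ∈ nullityOne M r := by
      intro z hz
      have hzX : z ∉ X := fun h => hz (subset_closureFinset hE X h)
      have hzw : z ≠ w := fun h => hzX (h ▸ Finset.mem_of_mem_erase (hC₁Z hwC₁))
      refine Finset.mem_filter.2 ⟨mem_nonbases.2 ⟨(card_insert_erase hx hzX).trans hXr,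
        fun hi => hZ (hi.subset (by exact_mod_cast Finset.subset_insert _ _))⟩, w,
        Finset.mem_insert_of_mem (hC₁Z hwC₁), ?_⟩
      rw [Finset.erase_insert_of_ne hzw]
      have hXw := indep_erase_of_mem_circuit hx₀ hXx₀ hC₁
        (hC₁Z.trans (Finset.erase_subset _ _)) hwC₁
      refine indep_insert_of_notMem_closure hE (hXw.subset ?_) fun hzc => hz ?_
      · rw [Finset.erase_right_comm]
        exact_mod_cast Finset.erase_subset _ _
      · refine mem_closureFinset.2 (M.closure_subset_closure ?_ hzc)
        exact_mod_cast (Finset.erase_subset _ _).trans (Finset.erase_subset _ _)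
    obtain ⟨z, hz, hzU⟩ : ∃ z ∉ closureFinset M X, insert z (X.erase x) ∉ U := by
      by_contra! hcon
      have := card_mul_card_le_johnson_degree X {x} (closureFinset M X)ᶜ U (by simpa using hx)
        (fun y hy h => Finset.mem_compl.1 hy (subset_closureFinset hE X h))
        (fun x' hx' z hz => by
          rw [Finset.mem_singleton.1 hx']; exact hcon z (Finset.mem_compl.1 hz))
      rw [Finset.card_singleton, one_mul, Finset.card_compl] at this
      have h1 : ((Fintype.card α - (closureFinset M X).card : ℕ) : ℝ)
          ≤ (johnsonDegree U X : ℝ) := by exact_mod_cast this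
      rw [Nat.cast_sub (Finset.card_le_univ _)] at h1
      linarith
    rcases hU _ (hone z hz) hzU with ⟨C', hC', hsub⟩ | ⟨H, hH, hsub⟩
    · -- `z` is not in any circuit of `X - x + z`, so the covering circuit would lie in `X`.
      refine absurd ?_ (hX𝒞 C' hC')
      have hzC' : z ∉ C' := by
        intro hzC'
        apply hz
        refine mem_closureFinset.2 (M.closure_subset_closure ?_
          ((h𝒞 C' hC').mem_closure_sdiff_singleton_of_mem (e := z) hzC'))
        rintro a ⟨ha, haz⟩
        rcases Finset.mem_insert.1 (hsub ha) with h | h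
        · exact absurd h haz
        · exact_mod_cast Finset.mem_of_mem_erase h
      intro a ha
      rcases Finset.mem_insert.1 (hsub ha) with h | h
      · exact absurd (h ▸ ha) hzC'
      · exact Finset.mem_of_mem_erase h
    · refine ⟨H, hH, Finset.eq_singleton_iff_nonempty_unique_mem.2
        ⟨Finset.sdiff_nonempty.2 (hXℋ H hH), fun a ha => ?_⟩⟩
      rw [Finset.mem_sdiff] at ha
      by_contra hax
      exact ha.2 (hsub (Finset.mem_insert_of_mem (Finset.mem_erase.2 ⟨hax, ha.1⟩)))

/-- The nonbases of a matroid of rank `r` are recovered from a stable family together with three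
short lists of sets. The bound on the lists is effective when `δ` is much larger than `n` but
much smaller than `n²`, and `δ'` is of order `n`. -/
theorem exists_decode_eq_nonbases (hE : M.E = Set.univ) (hr : M.eRank = r) (hr0 : 0 < r)
    (hrn : r < Fintype.card α) {δ δ' L A : ℝ} (hδ : 0 < δ) (hδ' : 0 < δ') (hL : 0 ≤ L)
    (h1 : 2 * δ ≤ r * (Fintype.card α - r))
    (h2 : δ' * r ≤ (Fintype.card α - r) * r - 2 * δ)
    (h3 : δ' * (Fintype.card α - r) ≤ r * (Fintype.card α - r) - 2 * δ)
    (hA : 2 * ((Fintype.card α).choose r * L / δ) + 3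
      + 3 * ((Fintype.card α).choose r * Real.exp (-L))
      + ((Fintype.card α).choose r * (r + δ) / (r * (Fintype.card α - r + 1))) * L / δ' ≤ A) :
    ∃ 𝒞 ℋ 𝒳 I : Finset (Finset α), (𝒞.card : ℝ) ≤ A ∧ (ℋ.card : ℝ) ≤ A ∧ (𝒳.card : ℝ) ≤ A ∧
      IsStableFamily r I ∧ decode r 𝒞 ℋ 𝒳 I = nonbases M r := by
  obtain ⟨K₀, hK₀⟩ : ∃ K₀, K₀ = nonbases M r \ nullityOne M r := ⟨_, rfl⟩
  have hK₀m : ∀ {X}, X ∈ K₀ ↔ X ∈ nonbases M r ∧ X ∉ nullityOne M r := by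
    intro X; rw [hK₀, Finset.mem_sdiff]
  have hK₁K : nullityOne M r ⊆ nonbases M r := Finset.filter_subset _ _
  have hK₀K : K₀ ⊆ nonbases M r := fun X hX => (hK₀m.1 hX).1
  have hKN : (nonbases M r).card ≤ (Fintype.card α).choose r := by
    rw [← Finset.card_univ, ← Finset.card_powersetCard]
    exact Finset.card_le_card (Finset.filter_subset _ _)
  have hcirc : ∀ X, ∃ C : Finset α, X ∈ nonbases M r → C ⊆ X ∧ M.IsCircuit (C : Set α) := by
    intro X
    by_cases hX : X ∈ nonbases M r
    · obtain ⟨C, h⟩ := exists_circuit_subset hE hX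
      exact ⟨C, fun _ => h⟩
    · exact ⟨∅, fun h => absurd h hX⟩
  choose circ hcirc using hcirc
  -- A neighbour of a set of nullity one is covered by its circuit or by its closure.
  have hnear : ∀ s ∈ nullityOne M r, ∀ X ∈ nonbases M r, (X = s ∨ JohnsonAdj X s) →
      circ s ⊆ X ∨ X ⊆ closureFinset M s := by
    intro s hs X hX hXs
    obtain ⟨hsK, x₀, hx₀, hi⟩ := Finset.mem_filter.1 hs
    rcases hXs with rfl | hadj
    · exact Or.inl (hcirc _ hsK).1
    · refine (circuit_subset_or_subset_closure hE hx₀ hi (hcirc s hsK).2 (hcirc s hsK).1 hadj.symm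
        (mem_nonbases.1 hX).2).imp_right fun h => ?_
      rw [← coe_closureFinset] at h
      exact_mod_cast h
  -- Sets with many dependent neighbours are covered with the help of few sets: those with many
  -- neighbours of nullity one by `S₁`, those with many neighbours of larger nullity by `S₀`.
  obtain ⟨S₁, hS₁, hS₁c, hS₁h⟩ := exists_small_hitting (nullityOne M r)
    ((nonbases M r).filter fun X => δ ≤ (johnsonDegree (nullityOne M r) X : ℝ)) JohnsonAdj
    δ L hδ hL (fun X hX => (Finset.mem_filter.1 hX).2)
  obtain ⟨S₀, hS₀, hS₀c, hS₀h⟩ := exists_small_hitting K₀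
    ((nonbases M r).filter fun X => δ ≤ (johnsonDegree K₀ X : ℝ)) JohnsonAdj
    δ L hδ hL (fun X hX => (Finset.mem_filter.1 hX).2)
  -- The sets of nullity one not covered by the circuits and flats found so far have small degree,
  -- so there are few of them; this makes a second round with the smaller threshold `δ'` cheap.
  obtain ⟨U, hU⟩ : ∃ U : Finset (Finset α), ∀ X, X ∈ U ↔ X ∈ nullityOne M r ∧
      ∀ s ∈ S₁ ∪ S₀, s ∈ nullityOne M r → ¬ circ s ⊆ X ∧ ¬ X ⊆ closureFinset M s :=
    ⟨(nullityOne M r).filter _, fun X => Finset.mem_filter⟩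
  have hUK₁ : U ⊆ nullityOne M r := fun X hX => ((hU X).1 hX).1
  obtain ⟨S₂, hS₂, hS₂c, hS₂h⟩ := exists_small_hitting U
    (U.filter fun X => δ' ≤ (johnsonDegree U X : ℝ)) JohnsonAdj δ' L hδ' hL
    (fun X hX => (Finset.mem_filter.1 hX).2)
  have hUdeg : ∀ X ∈ U, (johnsonDegree U X : ℝ) ≤ δ := by
    intro X hX
    by_contra! hlt
    obtain ⟨hXK₁, hXu⟩ := (hU X).1 hX
    have hXK := hK₁K hXK₁
    have hT : X ∈ (nonbases M r).filter fun X => δ ≤ (johnsonDegree (nullityOne M r) X : ℝ) := by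
      refine Finset.mem_filter.2 ⟨hXK, hlt.le.trans ?_⟩
      exact_mod_cast Finset.card_le_card (Finset.filter_subset_filter _ hUK₁)
    rcases hS₁h X hT with h | ⟨s, hs, hsK₁, hadj⟩
    · exact (hXu X (Finset.mem_union_left _ h) hXK₁).1 (hcirc X hXK).1
    · have := hXu s (Finset.mem_union_left _ hs) hsK₁
      rcases hnear s hsK₁ X hXK (Or.inr hadj) with h | h
      · exact this.1 h
      · exact this.2 h
  obtain ⟨S, hS⟩ : ∃ S, S = S₁ ∪ S₀ ∪ S₂ := ⟨_, rfl⟩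
  obtain ⟨𝒞, h𝒞⟩ : ∃ 𝒞, 𝒞 = (S.filter (· ∈ nullityOne M r)).image circ := ⟨_, rfl⟩
  obtain ⟨ℋ, hℋ⟩ : ∃ ℋ, ℋ = (S.filter (· ∈ nullityOne M r)).image (closureFinset M) := ⟨_, rfl⟩
  obtain ⟨𝒳, h𝒳⟩ : ∃ 𝒳, 𝒳 = S.filter (· ∈ K₀) := ⟨_, rfl⟩
  have h𝒞m : ∀ s ∈ S, s ∈ nullityOne M r → circ s ∈ 𝒞 := fun s hs hs1 => by
    rw [h𝒞]; exact Finset.mem_image_of_mem _ (Finset.mem_filter.2 ⟨hs, hs1⟩)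
  have hℋm : ∀ s ∈ S, s ∈ nullityOne M r → closureFinset M s ∈ ℋ := fun s hs hs1 => by
    rw [hℋ]; exact Finset.mem_image_of_mem _ (Finset.mem_filter.2 ⟨hs, hs1⟩)
  -- Everything near a member of `S` is covered.
  have hcov : ∀ X ∈ nonbases M r, ∀ s ∈ S, s ∈ nonbases M r → (X = s ∨ JohnsonAdj X s) →
      IsCovered 𝒞 ℋ 𝒳 X := by
    intro X hX s hs hsK hXs
    by_cases hs1 : s ∈ nullityOne M r
    · rcases hnear s hs1 X hX hXs with h | h
      · exact Or.inl ⟨circ s, h𝒞m s hs hs1, h⟩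
      · exact Or.inr (Or.inl ⟨closureFinset M s, hℋm s hs hs1, h⟩)
    · exact Or.inr (Or.inr ⟨s, h𝒳 ▸ Finset.mem_filter.2 ⟨hs, hK₀m.2 ⟨hsK, hs1⟩⟩,
        hXs.imp_right JohnsonAdj.symm⟩)
  obtain ⟨I, hIV, hIst, hImax⟩ := exists_maximal_stable r
    ((nonbases M r).filter fun X => ¬ IsCovered 𝒞 ℋ 𝒳 X)
    (fun X hX => (mem_nonbases.1 (Finset.mem_filter.1 hX).1).1)
  have h𝒞c : ∀ C ∈ 𝒞, M.IsCircuit (C : Set α) := by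
    intro C hC
    rw [h𝒞] at hC
    obtain ⟨s, hs, rfl⟩ := Finset.mem_image.1 hC
    exact (hcirc s (hK₁K (Finset.mem_filter.1 hs).2)).2
  have hℋc : ∀ H ∈ ℋ, M.closure H = H ∧ (H : Set α) ≠ M.E := by
    intro H hH
    rw [hℋ] at hH
    obtain ⟨s, hs, rfl⟩ := Finset.mem_image.1 hH
    rw [coe_closureFinset]
    exact ⟨M.closure_closure _, closureFinset_ne_ground hE hr (hK₁K (Finset.mem_filter.1 hs).2)⟩
  have h𝒳c : ∀ X ∈ 𝒳, X ∈ nonbases M r ∧ ∀ x ∈ X, ¬ M.Indep (X.erase x : Set α) := by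
    intro X hX
    rw [h𝒳] at hX
    obtain ⟨hXK, hX1⟩ := hK₀m.1 (Finset.mem_filter.1 hX).2
    exact ⟨hXK, fun x hx hi => hX1 (Finset.mem_filter.2 ⟨hXK, x, hx, hi⟩)⟩
  -- The size of the lists.
  have hScard : (S.card : ℝ) ≤ A := by
    have hu : (S.card : ℝ) ≤ S₁.card + S₀.card + S₂.card := by
      have ha := Finset.card_union_le (S₁ ∪ S₀) S₂
      have hb := Finset.card_union_le S₁ S₀
      have : S.card ≤ S₁.card + S₀.card + S₂.card := by rw [hS]; omega
      exact_mod_cast this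
    have hKN' : ((nonbases M r).card : ℝ) ≤ (Fintype.card α).choose r := by exact_mod_cast hKN
    have hc : ∀ F : Finset (Finset α), F ⊆ nonbases M r →
        (F.card : ℝ) ≤ (Fintype.card α).choose r := fun F hF =>
      le_trans (by exact_mod_cast Finset.card_le_card hF) hKN'
    have e1 := hc (nullityOne M r) hK₁K
    have e0 := hc K₀ hK₀K
    have e2 := hc _ (Finset.filter_subset
      (fun X => δ ≤ (johnsonDegree (nullityOne M r) X : ℝ)) (nonbases M r))
    have e3 := hc _ (Finset.filter_subset
      (fun X => δ ≤ (johnsonDegree K₀ X : ℝ)) (nonbases M r))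
    have e4 := hc _ ((Finset.filter_subset
      (fun X => δ' ≤ (johnsonDegree U X : ℝ)) U).trans (hUK₁.trans hK₁K))
    have hrpos : (0 : ℝ) < r := by exact_mod_cast hr0
    have hnr : (0 : ℝ) < Fintype.card α - r + 1 := by
      have : (r : ℝ) < Fintype.card α := by exact_mod_cast hrn
      linarith
    have eU : (U.card : ℝ) ≤
        (Fintype.card α).choose r * (r + δ) / (r * (Fintype.card α - r + 1)) := by
      rw [le_div_iff₀ (by positivity)]
      exact card_le_of_johnson_degree_le r hr0 hrn.le U
        (fun X hX => (mem_nonbases.1 (hK₁K (hUK₁ hX))).1) δ hδ.le hUdeg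
    have f1 : ((nullityOne M r).card : ℝ) * L / δ ≤ (Fintype.card α).choose r * L / δ := by gcongr
    have f0 : (K₀.card : ℝ) * L / δ ≤ (Fintype.card α).choose r * L / δ := by gcongr
    have fU : (U.card : ℝ) * L / δ' ≤
        (Fintype.card α).choose r * (r + δ) / (r * (Fintype.card α - r + 1)) * L / δ' := by gcongr
    have g2 := mul_le_mul_of_nonneg_right e2 (Real.exp_pos (-L)).le
    have g3 := mul_le_mul_of_nonneg_right e3 (Real.exp_pos (-L)).le
    have g4 := mul_le_mul_of_nonneg_right e4 (Real.exp_pos (-L)).le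
    linarith
  have hfS : ∀ (p : Finset α → Prop) [DecidablePred p], ((S.filter p).card : ℝ) ≤ A := fun p _ =>
    le_trans (Nat.cast_le.2 (Finset.card_filter_le _ _)) hScard
  have h𝒞A : (𝒞.card : ℝ) ≤ A := by
    refine le_trans ?_ (hfS (· ∈ nullityOne M r))
    rw [h𝒞]
    exact Nat.cast_le.2 Finset.card_image_le
  have hℋA : (ℋ.card : ℝ) ≤ A := by
    refine le_trans ?_ (hfS (· ∈ nullityOne M r))
    rw [hℋ]
    exact Nat.cast_le.2 Finset.card_image_le
  have h𝒳A : (𝒳.card : ℝ) ≤ A := by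
    rw [h𝒳]
    exact hfS _
  refine ⟨𝒞, ℋ, 𝒳, I, h𝒞A, hℋA, h𝒳A, hIst, ?_⟩
  refine Finset.Subset.antisymm (decode_subset_nonbases hE hr h𝒞c hℋc h𝒳c
    (hIV.trans (Finset.filter_subset _ _))) fun Y hY => ?_
  have hYr := (mem_nonbases.1 hY).1
  simp only [decode, Finset.mem_filter, Finset.mem_powersetCard_univ]
  refine ⟨hYr, ?_⟩
  by_cases hYc : IsCovered 𝒞 ℋ 𝒳 Y
  · exact Or.inl hYc
  right
  refine (hImax Y (Finset.mem_filter.2 ⟨hY, hYc⟩)).imp_right ?_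
  rintro ⟨X, hXI, hadj⟩
  refine ⟨X, hXI, ?_⟩
  obtain ⟨hXK, hXc⟩ := Finset.mem_filter.1 (hIV hXI)
  have hSK : S ⊆ nonbases M r := by
    rw [hS]
    refine Finset.union_subset (Finset.union_subset (hS₁.trans ?_) (hS₀.trans ?_)) (hS₂.trans ?_)
    · exact Finset.union_subset hK₁K (Finset.filter_subset _ _)
    · exact Finset.union_subset hK₀K (Finset.filter_subset _ _)
    · exact Finset.union_subset (hUK₁.trans hK₁K)
        ((Finset.filter_subset _ _).trans (hUK₁.trans hK₁K))
  have hS₁S : S₁ ⊆ S := hS ▸ Finset.subset_union_left.trans Finset.subset_union_left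
  have hS₀S : S₀ ⊆ S := hS ▸ Finset.subset_union_right.trans Finset.subset_union_left
  have hS₂S : S₂ ⊆ S := hS ▸ Finset.subset_union_right
  -- The uncovered set `X` has small degree.
  have hd1 : (johnsonDegree (nullityOne M r) X : ℝ) < δ := by
    by_contra! hle
    apply hXc
    rcases hS₁h X (Finset.mem_filter.2 ⟨hXK, hle⟩) with h | ⟨s, hs, -, h⟩
    · exact hcov X hXK X (hS₁S h) hXK (Or.inl rfl)
    · exact hcov X hXK s (hS₁S hs) (hSK (hS₁S hs)) (Or.inr h)
  have hd0 : (johnsonDegree K₀ X : ℝ) < δ := by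
    by_contra! hle
    apply hXc
    rcases hS₀h X (Finset.mem_filter.2 ⟨hXK, hle⟩) with h | ⟨s, hs, -, h⟩
    · exact hcov X hXK X (hS₀S h) hXK (Or.inl rfl)
    · exact hcov X hXK s (hS₀S hs) (hSK (hS₀S hs)) (Or.inr h)
  have hd : (johnsonDegree (nonbases M r) X : ℝ) < 2 * δ := by
    have hle : johnsonDegree (nonbases M r) X ≤
        johnsonDegree (nullityOne M r) X + johnsonDegree K₀ X := by
      refine le_trans (Finset.card_le_card ?_) (Finset.card_union_le _ _)
      rw [← Finset.filter_union, hK₀, Finset.union_sdiff_of_subset hK₁K]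
    have : (johnsonDegree (nonbases M r) X : ℝ) ≤
        johnsonDegree (nullityOne M r) X + johnsonDegree K₀ X := by
      exact_mod_cast hle
    linarith
  have hnr : ((Fintype.card α - r : ℕ) : ℝ) = Fintype.card α - r := Nat.cast_sub hrn.le
  have hrpos : (0 : ℝ) < r := by exact_mod_cast hr0
  have hnrpos : (0 : ℝ) < Fintype.card α - r := by
    have : (r : ℝ) < Fintype.card α := by exact_mod_cast hrn
    linarith
  have hXK₁ : X ∈ nullityOne M r := by
    by_contra hX1
    have : ((r * (Fintype.card α - r) : ℕ) : ℝ) ≤ (johnsonDegree (nonbases M r) X : ℝ) := by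
      exact_mod_cast card_mul_le_degree_of_notMem_nullityOne hXK hX1
    rw [Nat.cast_mul, hnr] at this
    linarith
  have hX𝒞 : ∀ C ∈ 𝒞, ¬ C ⊆ X := fun C hC h => hXc (Or.inl ⟨C, hC, h⟩)
  have hXℋ : ∀ H ∈ ℋ, ¬ X ⊆ H := fun H hH h => hXc (Or.inr (Or.inl ⟨H, hH, h⟩))
  have hlist : ∀ s ∈ S₁ ∪ S₀, s ∈ nullityOne M r →
      circ s ∈ 𝒞 ∧ closureFinset M s ∈ ℋ := fun s hs hs1 =>
    have hm : s ∈ S := Finset.union_subset hS₁S hS₀S hs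
    ⟨h𝒞m s hm hs1, hℋm s hm hs1⟩
  have hXU : X ∈ U := (hU X).2 ⟨hXK₁, fun s hs hs1 =>
    ⟨hX𝒞 _ (hlist s hs hs1).1, hXℋ _ (hlist s hs hs1).2⟩⟩
  have hd2 : (johnsonDegree U X : ℝ) < δ' := by
    by_contra! hle
    apply hXc
    rcases hS₂h X (Finset.mem_filter.2 ⟨hXU, hle⟩) with h | ⟨s, hs, -, h⟩
    · exact hcov X hXK X (hS₂S h) hXK (Or.inl rfl)
    · exact hcov X hXK s (hS₂S hs) (hSK (hS₂S hs)) (Or.inr h)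
  refine isForcedExchange_of_johnsonAdj hE hr h𝒞c (fun H hH => (hℋc H hH).1) hXK₁ hY hadj
    (hcirc X hXK).2 (hcirc X hXK).1 hX𝒞 hXℋ (U := U) ?_ hd2 ?_ ?_
  · intro X' hX' hX'U
    have : ¬ ∀ s ∈ S₁ ∪ S₀, s ∈ nullityOne M r → ¬ circ s ⊆ X' ∧
        ¬ X' ⊆ closureFinset M s := fun h => hX'U ((hU X').2 ⟨hX', h⟩)
    push Not at this
    obtain ⟨s, hs, hs1, h⟩ := this
    by_cases hc : circ s ⊆ X'
    · exact Or.inl ⟨_, (hlist s hs hs1).1, hc⟩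
    · exact Or.inr ⟨_, (hlist s hs hs1).2, h hc⟩
  -- A large closure or a small circuit would give `X` at least `2 * δ` dependent neighbours.
  · have hc : ((r * ((closureFinset M X).card - r) : ℕ) : ℝ) ≤
        (johnsonDegree (nonbases M r) X : ℝ) := by
      exact_mod_cast card_closure_le_degree hE hr hXK
    rw [Nat.cast_mul, Nat.cast_sub (by
      rw [← (mem_nonbases.1 hXK).1]; exact Finset.card_le_card (subset_closureFinset hE X))] at hc
    nlinarith
  · have hc : (((r - (circ X).card) * (Fintype.card α - r) : ℕ) : ℝ) ≤
        (johnsonDegree (nonbases M r) X : ℝ) := by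
      exact_mod_cast card_sub_circuit_le_degree hXK (hcirc X hXK).2 (hcirc X hXK).1
    rw [Nat.cast_mul, hnr, Nat.cast_sub (by
      rw [← (mem_nonbases.1 hXK).1]; exact Finset.card_le_card (hcirc X hXK).1)] at hc
    nlinarith

end Description

/-! ### Counting matroids of a given rank -/

/-- The matroids of rank `r` whose ground set is all of `Fin n`. -/
def matroidsOfRank (n r : ℕ) : Set (Matroid (Fin n)) :=
  {M | M.E = Set.univ ∧ M.eRank = r}

/-- A matroid of rank `r` is determined by its nonbases. -/
theorem nonbases_injOn (n r : ℕ) :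
    Set.InjOn (fun M : Matroid (Fin n) => nonbases M r) (matroidsOfRank n r) := by
  rintro M ⟨hME, hMr⟩ N ⟨hNE, hNr⟩ h
  have key : ∀ {M' : Matroid (Fin n)}, M'.eRank = r → ∀ B : Finset (Fin n),
      M'.IsBase B ↔ B.card = r ∧ B ∉ nonbases M' r := by
    intro M' hr B
    rw [mem_nonbases]
    constructor
    · intro hB
      have hc : (B.card : ℕ∞) = r := by
        rw [← hr, ← hB.encard_eq_eRank, Set.encard_coe_eq_coe_finsetCard]
      exact ⟨by exact_mod_cast hc, fun h => h.2 hB.indep⟩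
    · rintro ⟨hB, h⟩
      have hi : M'.Indep (B : Set (Fin n)) := by tauto
      refine hi.isBase_of_eRk_ge B.finite_toSet ?_
      rw [hr, hi.eRk_eq_encard, Set.encard_coe_eq_coe_finsetCard, hB]
  refine Matroid.ext_isBase (hME.trans hNE.symm) fun B _ => ?_
  lift B to Finset (Fin n) using B.toFinite
  have h' : nonbases M r = nonbases N r := h
  rw [key hMr, key hNr, h']

theorem ncard_matroidsOfRank_le_two_pow (n r : ℕ) :
    (matroidsOfRank n r).ncard ≤ 2 ^ n.choose r := by
  classical
  have : 2 ^ n.choose r =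
      ((Finset.powersetCard r (Finset.univ : Finset (Fin n))).powerset).card := by
    simp
  rw [this, ← Set.ncard_coe_finset]
  refine Set.ncard_le_ncard_of_injOn _ (fun M _ => ?_) (nonbases_injOn n r) (Set.toFinite _)
  rw [Finset.mem_coe, Finset.mem_powerset]
  exact Finset.filter_subset _ _

/-- The families of at most `A` subsets of `Fin n`. -/
noncomputable def smallFamilies (n : ℕ) (A : ℝ) : Finset (Finset (Finset (Fin n))) :=
  Finset.univ.filter fun 𝒮 => (𝒮.card : ℝ) ≤ A

/-- Weighting each family `𝒮` by `x ^ #𝒮` gives total weight `(1 + x) ^ (2 ^ n)`, while each family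
of at most `A` sets has weight at least `x ^ A`. -/
theorem card_smallFamilies_le (n : ℕ) (A x : ℝ) (hx : 0 < x) (hx1 : x ≤ 1) :
    ((smallFamilies n A).card : ℝ) ≤ Real.exp (A * Real.log x⁻¹ + x * 2 ^ n) := by
  have h1 : ((smallFamilies n A).card : ℝ) * x ^ A ≤ (x + 1) ^ (2 ^ n) := by
    have hsum := Finset.sum_pow_mul_eq_add_pow x 1 (Finset.univ : Finset (Finset (Fin n)))
    rw [Finset.card_univ, Fintype.card_finset, Fintype.card_fin] at hsum
    rw [← hsum, ← nsmul_eq_mul, ← Finset.sum_const]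
    refine (Finset.sum_le_sum fun 𝒮 h𝒮 => ?_).trans
      (Finset.sum_le_sum_of_subset_of_nonneg (s := smallFamilies n A)
        (fun 𝒮 _ => by simp) fun _ _ _ => by positivity)
    rw [one_pow, mul_one, ← Real.rpow_natCast]
    exact Real.rpow_le_rpow_of_exponent_ge hx hx1 (Finset.mem_filter.1 h𝒮).2
  have h2 : (x + 1) ^ (2 ^ n) ≤ Real.exp (x * 2 ^ n) := by
    calc (x + 1) ^ (2 ^ n) ≤ (Real.exp x) ^ (2 ^ n) := by
          gcongr; exact Real.add_one_le_exp x
      _ = Real.exp (x * 2 ^ n) := by rw [← Real.exp_nat_mul]; push_cast; rw [mul_comm]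
  have h3 : x ^ A = Real.exp (-(A * Real.log x⁻¹)) := by
    rw [Real.rpow_def_of_pos hx, Real.log_inv]; ring_nf
  rw [Real.exp_add]
  have h4 := h1.trans h2
  rw [h3, Real.exp_neg, ← div_eq_mul_inv, div_le_iff₀ (Real.exp_pos _)] at h4
  linarith

/-- The number of matroids of rank `r` is at most the number of sparse paving matroids times the
number of choices for three short lists of sets. -/
theorem ncard_matroidsOfRank_le {n r : ℕ} (hr0 : 0 < r)
    (hrn : r < n) {δ δ' L A : ℝ} (hδ : 0 < δ) (hδ' : 0 < δ') (hL : 0 ≤ L)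
    (h1 : 2 * δ ≤ r * (n - r)) (h2 : δ' * r ≤ (n - r) * r - 2 * δ)
    (h3 : δ' * (n - r) ≤ r * (n - r) - 2 * δ)
    (hA : 2 * (n.choose r * L / δ) + 3 + 3 * (n.choose r * Real.exp (-L))
      + (n.choose r * (r + δ) / (r * (n - r + 1))) * L / δ' ≤ A) :
    (matroidsOfRank n r).ncard ≤ (smallFamilies n A).card ^ 3 * numSparsePaving n := by
  classical
  set P := smallFamilies n A ×ˢ smallFamilies n A ×ˢ smallFamilies n A ×ˢ
    Finset.univ.filter fun I : Finset (Finset (Fin n)) => IsStableFamily r I with hP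
  calc (matroidsOfRank n r).ncard
      ≤ ((P.image fun p => decode r p.1 p.2.1 p.2.2.1 p.2.2.2 :
          Finset (Finset (Finset (Fin n)))) : Set (Finset (Finset (Fin n)))).ncard := by
        refine Set.ncard_le_ncard_of_injOn _ ?_ (nonbases_injOn n r) (Set.toFinite _)
        rintro M ⟨hE, hr⟩
        obtain ⟨𝒞, ℋ, 𝒳, I, h𝒞, hℋ, h𝒳, hI, hdec⟩ := exists_decode_eq_nonbases hE hr hr0
          (by rwa [Fintype.card_fin]) hδ hδ' hL (by rwa [Fintype.card_fin])
          (by rwa [Fintype.card_fin]) (by rwa [Fintype.card_fin]) (A := A)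
          (by rwa [Fintype.card_fin])
        rw [Finset.mem_coe, Finset.mem_image]
        exact ⟨(𝒞, ℋ, 𝒳, I), by simp [hP, smallFamilies, h𝒞, hℋ, h𝒳, hI], hdec⟩
    _ ≤ P.card := by rw [Set.ncard_coe_finset]; exact Finset.card_image_le
    _ ≤ _ := by
        rw [hP, Finset.card_product, Finset.card_product, Finset.card_product]
        have := card_isStableFamily_le_numSparsePaving hr0 hrn
        calc _ = (smallFamilies n A).card ^ 3 *
              (Finset.univ.filter fun I : Finset (Finset (Fin n)) => IsStableFamily r I).card := by
                ring
          _ ≤ _ := by gcongr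

theorem numMatroids_le_sum (n : ℕ) :
    numMatroids n ≤ ∑ r ∈ Finset.range (n + 1), (matroidsOfRank n r).ncard := by
  have hfin : Finite (Matroid (Fin n)) := finite_matroid_of_finite
  refine le_trans (Set.ncard_le_ncard (t := ⋃ r ∈ Finset.range (n + 1), matroidsOfRank n r) ?_
    (Set.toFinite _)) (Finset.set_ncard_biUnion_le _ _)
  intro M hM
  have hle := M.eRank_le_encard_ground
  have hM' : M.E = Set.univ := hM
  rw [hM', Set.encard_univ, ENat.card_eq_coe_fintype_card, Fintype.card_fin] at hle
  obtain ⟨r, hr⟩ := ENat.ne_top_iff_exists.1 (ne_top_of_le_ne_top (ENat.natCast_ne_top n) hle)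
  rw [← hr] at hle
  have hle' : r ≤ n := by exact_mod_cast hle
  simp only [Set.mem_iUnion]
  exact ⟨r, Finset.mem_range.2 (by omega), hM', hr.symm⟩

/-! ### Binomial estimates -/

theorem two_mul_choose_le {n i : ℕ} (h : 3 * i + 2 ≤ n) : 2 * n.choose i ≤ n.choose (i + 1) := by
  have h1 := Nat.choose_succ_right_eq n i
  have h2 : 2 * (i + 1) ≤ n - i := by omega
  refine Nat.le_of_mul_le_mul_right (c := i + 1) ?_ (Nat.succ_pos i)
  rw [h1]
  calc 2 * n.choose i * (i + 1) = n.choose i * (2 * (i + 1)) := by ring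
    _ ≤ _ := Nat.mul_le_mul_left _ h2

theorem two_pow_mul_choose_le {n r : ℕ} (j : ℕ) (h : 3 * (r + j) ≤ n + 1) :
    2 ^ j * n.choose r ≤ n.choose (r + j) := by
  induction j with
  | zero => simp
  | succ j ih =>
    have h1 := ih (by omega)
    have h2 := two_mul_choose_le (n := n) (i := r + j) (by omega)
    calc 2 ^ (j + 1) * n.choose r = 2 * (2 ^ j * n.choose r) := by ring
      _ ≤ 2 * n.choose (r + j) := by omega
      _ ≤ _ := h2

theorem sq_le_two_pow_div {n : ℕ} (hn : 128 ≤ n) : n ^ 2 ≤ 2 ^ (n / 8) := by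
  have key : ∀ k ≥ 16, (8 * k + 8) ^ 2 ≤ 2 ^ k := by
    intro k hk
    induction k, hk using Nat.le_induction with
    | base => norm_num
    | succ k hk ih => rw [pow_succ 2 k]; nlinarith
  refine le_trans (Nat.pow_le_pow_left ?_ 2) (key (n / 8) (by omega))
  omega

theorem sq_mul_choose_le_middle_of_lt {n r : ℕ} (hn : 128 ≤ n) (hr : 8 * r < n) :
    n ^ 2 * n.choose r ≤ n.choose (n / 2) :=
  calc n ^ 2 * n.choose r ≤ 2 ^ (n / 8) * n.choose r :=
        Nat.mul_le_mul_right _ (sq_le_two_pow_div hn)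
    _ ≤ n.choose (r + n / 8) := two_pow_mul_choose_le _ (by omega)
    _ ≤ n.choose (n / 2) := Nat.choose_le_middle _ _

/-- Away from the middle ranks the binomial coefficients are negligible. -/
theorem sq_mul_choose_le_middle {n r : ℕ} (hn : 128 ≤ n) (hrn : r ≤ n)
    (hr : 8 * r < n ∨ 8 * (n - r) < n) : n ^ 2 * n.choose r ≤ n.choose (n / 2) := by
  rcases hr with hr | hr
  · exact sq_mul_choose_le_middle_of_lt hn hr
  · rw [← Nat.choose_symm hrn]
    exact sq_mul_choose_le_middle_of_lt hn hr

theorem two_pow_le_mul_middle (n : ℕ) : 2 ^ n ≤ (n + 1) * n.choose (n / 2) := by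
  rw [← Nat.sum_range_choose]
  calc _ ≤ ∑ _m ∈ Finset.range (n + 1), n.choose (n / 2) :=
        Finset.sum_le_sum fun m _ => Nat.choose_le_middle m n
    _ = _ := by simp

theorem cube_le_middle {n : ℕ} (hn : 128 ≤ n) : n ^ 3 ≤ n.choose (n / 2) := by
  have h1 := sq_le_two_pow_div hn
  have h2 := two_pow_le_mul_middle n
  have h3 : n ^ 6 ≤ 2 ^ n := by
    calc n ^ 6 = (n ^ 2) ^ 3 := by ring
      _ ≤ (2 ^ (n / 8)) ^ 3 := Nat.pow_le_pow_left h1 3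
      _ = 2 ^ (n / 8 * 3) := by rw [pow_mul]
      _ ≤ 2 ^ n := Nat.pow_le_pow_right (by norm_num) (by omega)
  have h4 : (n + 1) * n ^ 3 ≤ n ^ 6 := by
    have : n + 1 ≤ n ^ 3 := by nlinarith [Nat.pow_le_pow_left hn 2]
    calc (n + 1) * n ^ 3 ≤ n ^ 3 * n ^ 3 := Nat.mul_le_mul_right _ this
      _ = _ := by ring
  exact Nat.le_of_mul_le_mul_left (h4.trans (h3.trans h2)) (Nat.succ_pos n)

/-! ### Asymptotics -/

/-- The bound in a middle rank. Here `w` is the eighth root of `n`; the description is used with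
degree thresholds `δ = n ^ (3 / 2)` and `δ' = n / 16`, and with `L = 2 log n`. The lists then have
size `O(log n * n ^ (-3 / 2))` relative to the middle layer; the crude estimate `log w ≤ w` turns
this into `w ^ (-11)`, and once more into `w ^ (-10)` for the logarithm of the number of lists. -/
theorem ncard_matroidsOfRank_le_of_middle {n r : ℕ} {w : ℝ} (hw : 4 ≤ w) (hwn : w ^ 8 = n)
    (hr : n ≤ 8 * r) (hr' : n ≤ 8 * (n - r)) :
    ((matroidsOfRank n r).ncard : ℝ) ≤
      Real.exp (3000000 * (n.choose (n / 2) / w ^ 10)) * numSparsePaving n := by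
  have hw0 : 0 < w := by linarith
  have hw1 : 1 ≤ w := by linarith
  have hpow : ∀ {a b : ℕ}, a ≤ b → w ^ a ≤ w ^ b := fun h => pow_le_pow_right₀ hw1 h
  have hnbig : (65536 : ℝ) ≤ n := by
    rw [← hwn]
    calc (65536 : ℝ) = 4 ^ 8 := by norm_num
      _ ≤ w ^ 8 := by gcongr
  have hnbig' : 65536 ≤ n := by exact_mod_cast hnbig
  have hr0 : 0 < r := by omega
  have hrn : r < n := by omega
  have hlog : Real.log w ≤ w := Real.log_le_self hw0.le
  have hlog0 : 0 ≤ Real.log w := Real.log_nonneg hw1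
  set B : ℝ := (n.choose (n / 2) : ℝ) with hB
  have hBw : w ^ 24 ≤ B := by
    have h := cube_le_middle (n := n) (by omega)
    have h' : (n : ℝ) ^ 3 ≤ B := by rw [hB]; exact_mod_cast h
    calc w ^ 24 = (w ^ 8) ^ 3 := by ring
      _ ≤ B := by rw [hwn]; exact h'
  have hB0 : 0 < B := lt_of_lt_of_le (by positivity) hBw
  have hN : (n.choose r : ℝ) ≤ B := by rw [hB]; exact_mod_cast Nat.choose_le_middle r n
  have hN0 : (0 : ℝ) ≤ n.choose r := Nat.cast_nonneg _
  have hrR : w ^ 8 / 8 ≤ r := by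
    have : (n : ℝ) ≤ 8 * r := by exact_mod_cast hr
    rw [hwn]; linarith
  have hrR' : w ^ 8 / 8 ≤ (n : ℝ) - r := by
    have : (n : ℝ) ≤ 8 * ((n - r : ℕ) : ℝ) := by exact_mod_cast hr'
    rw [Nat.cast_sub hrn.le] at this
    rw [hwn]; linarith
  have hrle : (r : ℝ) ≤ w ^ 8 := by rw [hwn]; exact_mod_cast hrn.le
  have hw8 : 0 < w ^ 8 := by positivity
  have hw4 : 256 ≤ w ^ 4 := by
    calc (256 : ℝ) = 4 ^ 4 := by norm_num
      _ ≤ w ^ 4 := by gcongr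
  have h12 : 256 * w ^ 12 ≤ w ^ 16 := by
    calc 256 * w ^ 12 ≤ w ^ 4 * w ^ 12 := by gcongr
      _ = w ^ 16 := by ring
  have hprod : w ^ 16 / 64 ≤ r * ((n : ℝ) - r) := by
    calc w ^ 16 / 64 = (w ^ 8 / 8) * (w ^ 8 / 8) := by ring
      _ ≤ r * ((n : ℝ) - r) := by gcongr
  have hw16 : w ^ 16 = w ^ 8 * w ^ 8 := by ring
  have main := ncard_matroidsOfRank_le (n := n) (r := r) hr0 hrn (δ := w ^ 12) (δ' := w ^ 8 / 16)
    (L := 16 * Real.log w) (A := 40000 * (B / w ^ 11)) (by positivity) (by positivity)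
    (by positivity) (by nlinarith) (by
      have : w ^ 8 / 16 * (w ^ 8 / 8) ≤ ((n : ℝ) - r - w ^ 8 / 16) * r := by
        gcongr <;> linarith
      nlinarith) (by
      have : w ^ 8 / 16 * (w ^ 8 / 8) ≤ ((r : ℝ) - w ^ 8 / 16) * (n - r) := by
        gcongr <;> linarith
      nlinarith) (by
      have hexp : Real.exp (-(16 * Real.log w)) = 1 / w ^ 16 := by
        rw [Real.exp_neg, mul_comm, Real.exp_mul, Real.exp_log hw0, one_div]
        norm_cast
      have e1 : 2 * (n.choose r * (16 * Real.log w) / w ^ 12) ≤ 32 * (B / w ^ 11) := by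
        calc 2 * (n.choose r * (16 * Real.log w) / w ^ 12)
              ≤ 2 * (B * (16 * w) / w ^ 12) := by gcongr
          _ = 32 * (B / w ^ 11) := by field_simp; ring
      have e2 : 3 ≤ 3 * (B / w ^ 11) := by
        have : 1 ≤ B / w ^ 11 := by
          rw [le_div_iff₀ (by positivity), one_mul]
          exact (hpow (by norm_num)).trans hBw
        linarith
      have e3 : 3 * (n.choose r * Real.exp (-(16 * Real.log w))) ≤ 3 * (B / w ^ 11) := by
        rw [hexp, mul_one_div]
        gcongr
        norm_num
      have e4 : n.choose r * (r + w ^ 12) / (r * (n - r + 1)) * (16 * Real.log w) / (w ^ 8 / 16)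
          ≤ 32768 * (B / w ^ 11) := by
        have hnum : (r : ℝ) + w ^ 12 ≤ 2 * w ^ 12 := by
          have := hpow (show 8 ≤ 12 by norm_num)
          linarith
        have hden : w ^ 16 / 64 ≤ r * ((n : ℝ) - r + 1) := by nlinarith
        calc n.choose r * (r + w ^ 12) / (r * (n - r + 1)) * (16 * Real.log w) / (w ^ 8 / 16)
            ≤ B * (2 * w ^ 12) / (w ^ 16 / 64) * (16 * w) / (w ^ 8 / 16) := by gcongr
          _ = 32768 * (B / w ^ 11) := by field_simp; ring
      have : 0 ≤ B / w ^ 11 := by positivity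
      linarith)
  -- The parameter `x = w ^ (-24) = n ^ (-3)` makes `x * 2 ^ n` negligible, while `log x⁻¹` is only
  -- `O(log n)`.
  have hfam : ((smallFamilies n (40000 * (B / w ^ 11))).card : ℝ) ≤
      Real.exp (1000000 * (B / w ^ 10)) := by
    refine (card_smallFamilies_le n _ (1 / w ^ 24) (by positivity) ?_).trans (Real.exp_le_exp.2 ?_)
    · rw [div_le_one (by positivity)]
      exact one_le_pow₀ hw1
    · have h1 : 40000 * (B / w ^ 11) * Real.log (1 / w ^ 24)⁻¹ ≤ 960000 * (B / w ^ 10) := by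
        rw [one_div, inv_inv, Real.log_pow]
        calc 40000 * (B / w ^ 11) * (((24 : ℕ) : ℝ) * Real.log w)
            ≤ 40000 * (B / w ^ 11) * (((24 : ℕ) : ℝ) * w) := by gcongr
          _ = 960000 * (B / w ^ 10) := by push_cast; field_simp; ring
      have h2 : 1 / w ^ 24 * 2 ^ n ≤ 2 * (B / w ^ 10) := by
        have h3 : (2 : ℝ) ^ n ≤ (n + 1) * B := by
          rw [hB]; exact_mod_cast two_pow_le_mul_middle n
        have h4 : ((n : ℝ) + 1) ≤ 2 * w ^ 14 := by
          have := hpow (show 8 ≤ 14 by norm_num)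
          rw [← hwn]; nlinarith [one_le_pow₀ (n := 14) hw1]
        calc 1 / w ^ 24 * 2 ^ n ≤ 1 / w ^ 24 * ((2 * w ^ 14) * B) := by
              gcongr
              exact h3.trans (by gcongr)
          _ = 2 * (B / w ^ 10) := by field_simp
      have : 0 ≤ B / w ^ 10 := by positivity
      linarith
  calc ((matroidsOfRank n r).ncard : ℝ)
      ≤ (smallFamilies n (40000 * (B / w ^ 11))).card ^ 3 * numSparsePaving n := by
        exact_mod_cast main
    _ ≤ (Real.exp (1000000 * (B / w ^ 10))) ^ 3 * numSparsePaving n := by gcongr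
    _ = _ := by rw [← Real.exp_nat_mul]; congr 2; push_cast; ring

/-- The number of matroids exceeds the number of sparse paving matroids by a factor whose logarithm
is of smaller order than `n.choose (n / 2) / n`. -/
theorem numMatroids_le_exp_mul {n : ℕ} {w : ℝ} (hw : 4 ≤ w) (hwn : w ^ 8 = n) :
    (numMatroids n : ℝ) ≤
      Real.exp (4000000 * (n.choose (n / 2) / w ^ 10)) * numSparsePaving n := by
  have hw0 : 0 < w := by linarith
  have hw1 : 1 ≤ w := by linarith
  have hnbig : (65536 : ℝ) ≤ n := by
    rw [← hwn]
    calc (65536 : ℝ) = 4 ^ 8 := by norm_num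
      _ ≤ w ^ 8 := by gcongr
  have hnbig' : 65536 ≤ n := by exact_mod_cast hnbig
  obtain ⟨k, -, hk⟩ := two_pow_le_numSparsePaving (n := n) (by omega)
  have hs1 : (1 : ℝ) ≤ numSparsePaving n := by exact_mod_cast Nat.one_le_two_pow.trans hk
  set B : ℝ := (n.choose (n / 2) : ℝ) with hB
  have hBw : w ^ 24 ≤ B := by
    have h := cube_le_middle (n := n) (by omega)
    have h' : (n : ℝ) ^ 3 ≤ B := by rw [hB]; exact_mod_cast h
    calc w ^ 24 = (w ^ 8) ^ 3 := by ring
      _ ≤ B := by rw [hwn]; exact h'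
  have hB0 : 0 < B := lt_of_lt_of_le (by positivity) hBw
  have hrank : ∀ r ∈ Finset.range (n + 1), ((matroidsOfRank n r).ncard : ℝ) ≤
      Real.exp (3000000 * (B / w ^ 10)) * numSparsePaving n := by
    intro r hr
    have hrn : r ≤ n := by simpa [Nat.lt_succ_iff] using hr
    by_cases hmid : n ≤ 8 * r ∧ n ≤ 8 * (n - r)
    · exact ncard_matroidsOfRank_le_of_middle hw hwn hmid.1 hmid.2
    · -- In an outer rank even the trivial bound `2 ^ n.choose r` suffices.
      have h1 := sq_mul_choose_le_middle (n := n) (r := r) (by omega) hrn (by omega)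
      have h2 : (n : ℝ) ^ 2 * n.choose r ≤ B := by rw [hB]; exact_mod_cast h1
      have h3 : (n.choose r : ℝ) ≤ 3000000 * (B / w ^ 10) := by
        have h4 : (n.choose r : ℝ) ≤ B / w ^ 10 := by
          rw [le_div_iff₀ (by positivity)]
          calc (n.choose r : ℝ) * w ^ 10 ≤ n.choose r * w ^ 16 := by
                gcongr
                norm_num
            _ = (w ^ 8) ^ 2 * n.choose r := by ring
            _ ≤ B := by rw [hwn]; exact h2
        have : 0 ≤ B / w ^ 10 := by positivity
        linarith
      calc ((matroidsOfRank n r).ncard : ℝ) ≤ 2 ^ n.choose r := by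
            exact_mod_cast ncard_matroidsOfRank_le_two_pow n r
        _ ≤ (Real.exp 1) ^ n.choose r := by
            gcongr
            have := Real.add_one_le_exp (1 : ℝ)
            linarith
        _ = Real.exp (n.choose r) := by rw [← Real.exp_nat_mul, mul_one]
        _ ≤ Real.exp (3000000 * (B / w ^ 10)) := Real.exp_le_exp.2 h3
        _ ≤ _ := le_mul_of_one_le_right (Real.exp_pos _).le hs1
  have hsum : (numMatroids n : ℝ) ≤
      ∑ r ∈ Finset.range (n + 1), ((matroidsOfRank n r).ncard : ℝ) := by
    exact_mod_cast numMatroids_le_sum n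
  have hn1 : (n : ℝ) + 1 ≤ Real.exp (B / w ^ 10) := by
    refine (Real.add_one_le_exp _).trans (Real.exp_le_exp.2 ?_)
    rw [le_div_iff₀ (by positivity), ← hwn]
    calc w ^ 8 * w ^ 10 = w ^ 18 := by ring
      _ ≤ w ^ 24 := pow_le_pow_right₀ hw1 (by norm_num)
      _ ≤ B := hBw
  calc (numMatroids n : ℝ)
      ≤ ∑ _r ∈ Finset.range (n + 1), Real.exp (3000000 * (B / w ^ 10)) * numSparsePaving n :=
        hsum.trans (Finset.sum_le_sum hrank)
    _ = (n + 1) * (Real.exp (3000000 * (B / w ^ 10)) * numSparsePaving n) := by simp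
    _ ≤ Real.exp (B / w ^ 10) * (Real.exp (3000000 * (B / w ^ 10)) * numSparsePaving n) := by gcongr
    _ = Real.exp (3000001 * (B / w ^ 10)) * numSparsePaving n := by
        rw [← mul_assoc, ← Real.exp_add]; congr 2; ring
    _ ≤ _ := by
        gcongr
        norm_num

theorem numSparsePaving_le_numMatroids (n : ℕ) : numSparsePaving n ≤ numMatroids n := by
  have hfin : Finite (Matroid (Fin n)) := finite_matroid_of_finite
  exact Set.ncard_le_ncard (Set.sep_subset _ _) (Set.toFinite _)

/-- The relative error in comparing the two logarithms is `O(n ^ (-1 / 4))`. -/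
theorem logb_ratio_bound {n : ℕ} {w : ℝ} (hw : 4 ≤ w) (hwn : w ^ 8 = n) :
    0 < Real.logb 2 (numSparsePaving n) ∧
    0 ≤ Real.logb 2 (numMatroids n) / Real.logb 2 (numSparsePaving n) - 1 ∧
    Real.logb 2 (numMatroids n) / Real.logb 2 (numSparsePaving n) - 1 ≤ 8000000 / w ^ 2 := by
  have hw0 : 0 < w := by linarith
  have hnbig : (65536 : ℝ) ≤ n := by
    rw [← hwn]
    calc (65536 : ℝ) = 4 ^ 8 := by norm_num
      _ ≤ w ^ 8 := by gcongr
  have hnbig' : 65536 ≤ n := by exact_mod_cast hnbig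
  obtain ⟨k, hkB, hk⟩ := two_pow_le_numSparsePaving (n := n) (by omega)
  have hB1 : 1 ≤ n.choose (n / 2) := Nat.choose_pos (Nat.div_le_self _ _)
  have hm := numMatroids_le_exp_mul hw hwn
  have hsm : (numSparsePaving n : ℝ) ≤ numMatroids n := by
    exact_mod_cast numSparsePaving_le_numMatroids n
  set B : ℝ := (n.choose (n / 2) : ℝ) with hB
  have hB0 : 0 < B := by rw [hB]; exact_mod_cast hB1
  have hs0 : (0 : ℝ) < numSparsePaving n := by
    exact_mod_cast (Nat.two_pow_pos k).trans_le hk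
  have hkB' : B / w ^ 8 ≤ k := by
    rw [div_le_iff₀ (by positivity), hwn, hB, mul_comm]
    exact_mod_cast hkB
  have hlogs : B / w ^ 8 * (1 / 2) ≤ Real.log (numSparsePaving n) := by
    have h1 : k * Real.log 2 ≤ Real.log (numSparsePaving n) := by
      rw [← Real.log_pow]
      exact Real.log_le_log (by positivity) (by exact_mod_cast hk)
    have h2 : (1 / 2 : ℝ) ≤ Real.log 2 := by linarith [Real.log_two_gt_d9]
    calc B / w ^ 8 * (1 / 2) ≤ k * Real.log 2 := by gcongr
      _ ≤ _ := h1
  have hlogs0 : 0 < Real.log (numSparsePaving n) := lt_of_lt_of_le (by positivity) hlogs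
  have hratio : Real.logb 2 (numMatroids n) / Real.logb 2 (numSparsePaving n) =
      Real.log (numMatroids n) / Real.log (numSparsePaving n) := by
    have : Real.log 2 ≠ 0 := (Real.log_pos (by norm_num)).ne'
    rw [Real.logb, Real.logb]
    field_simp
  have hlogm : Real.log (numMatroids n) ≤
      4000000 * (B / w ^ 10) + Real.log (numSparsePaving n) := by
    rw [← Real.log_exp (4000000 * (B / w ^ 10)), ← Real.log_mul (Real.exp_pos _).ne' hs0.ne']
    exact Real.log_le_log (hs0.trans_le hsm) hm
  refine ⟨div_pos hlogs0 (Real.log_pos (by norm_num)), ?_, ?_⟩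
  · rw [hratio, sub_nonneg, le_div_iff₀ hlogs0, one_mul]
    exact Real.log_le_log hs0 hsm
  · rw [hratio, sub_le_iff_le_add, div_le_iff₀ hlogs0]
    have : 4000000 * (B / w ^ 10) ≤ 8000000 / w ^ 2 * Real.log (numSparsePaving n) := by
      calc 4000000 * (B / w ^ 10) = 8000000 / w ^ 2 * (B / w ^ 8 * (1 / 2)) := by
            field_simp; norm_num
        _ ≤ _ := by gcongr
    linarith

theorem mainTheorem1 :
    ∃ ε : ℕ → ℝ, Tendsto ε atTop (𝓝 0) ∧
      ∀ᶠ n : ℕ in atTop,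
        Real.logb 2 (numMatroids n : ℝ) = (1 + ε n) * Real.logb 2 (numSparsePaving n : ℝ) := by
  have hw8 : ∀ n : ℕ, ((n : ℝ) ^ (1 / 8 : ℝ)) ^ 8 = n := fun n => by
    rw [← Real.rpow_natCast, ← Real.rpow_mul (Nat.cast_nonneg n)]
    norm_num
  have hwtop : Tendsto (fun n : ℕ => (n : ℝ) ^ (1 / 8 : ℝ)) atTop atTop :=
    (tendsto_rpow_atTop (by norm_num)).comp tendsto_natCast_atTop_atTop
  refine ⟨fun n => Real.logb 2 (numMatroids n) / Real.logb 2 (numSparsePaving n) - 1, ?_, ?_⟩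
  · have hlim : Tendsto (fun n : ℕ => 8000000 / ((n : ℝ) ^ (1 / 8 : ℝ)) ^ 2) atTop (𝓝 0) :=
      tendsto_const_nhds.div_atTop ((tendsto_pow_atTop two_ne_zero).comp hwtop)
    refine tendsto_of_tendsto_of_tendsto_of_le_of_le' tendsto_const_nhds hlim ?_ ?_
    · filter_upwards [hwtop.eventually_ge_atTop 4] with n hn
      exact (logb_ratio_bound hn (hw8 n)).2.1
    · filter_upwards [hwtop.eventually_ge_atTop 4] with n hn
      exact (logb_ratio_bound hn (hw8 n)).2.2
  · filter_upwards [hwtop.eventually_ge_atTop 4] with n hn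
    have h := (logb_ratio_bound hn (hw8 n)).1
    rw [add_sub_cancel, div_mul_cancel₀ _ h.ne']
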